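/- **Notation.** A fuzzy number is a normal, fuzzy-convex, upper semicontinuous function $\mathfrak z:\mathbb R\to[0,1]$ with compact support. Its level sets are $[\mathfrak z]^r=\{x:\mathfrak z(x)\ge r\}$ for $0<r\le 1$, and $[\mathfrak z]^0$ is the closure of $\{x:\mathfrak z(x)>0\}$; write $[\mathfrak z]^r=[\underline{\mathfrak z}_r,\overline{\mathfrak z}_r]$. Let $\hat E_f$ be the set of fuzzy numbers for which $r\mapsto[\mathfrak z]^r$ is continuous on $[0,1]$ in the Hausdorff metric, with the metric $\mathbb D(\mathfrak p,\mathfrak q)=\sup_{0\le r\le1}\max\{|\underline{\mathfrak p}_r-\underline{\mathfrak q}_r|,|\overline{\mathfrak p}_r-\overline{\mathfrak q}_r|\}$. Sums and real multiples are formed on level sets. The Hukuhara difference $\mathfrak p\ominus\mathfrak q$ is the $\mathfrak w\in\hat E_f$ with $\mathfrak p=\mathfrak q+\mathfrak w$, if it exists; the generalized Hukuhara (gH) difference is the $\mathfrak w\in\hat E_f$ with $\mathfrak p=\mathfrak q+\mathfrak w$ or $\mathfrak q=\mathfrak p+(-1)\mathfrak w$, if it exists. The gH-partial derivative of a fuzzy-valued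 function is the $\mathbb D$-limit of its gH-difference quotients (one-sided at $x=a$ and $y=b$). It is of type (i) if its level sets are $[(\underline{\mathcal U}_r)',(\overline{\mathcal U}_r)']$, and of type (ii) if they are $[(\overline{\mathcal U}_r)',(\underline{\mathcal U}_r)']$, for all $r\in[0,1]$. Let $a,b,\rho_1,\rho_2>0$, $\varphi_1,\varphi_2\in(0,1]$, $\Omega=(0,a]\times(0,b]$ and $\overline\Omega=[0,a]\times[0,b]$. For orders $\alpha_1,\alpha_2>0$ the mixed Katugampola fractional integral is $$\mathfrak I^{\alpha,\rho}_{0^+}u(x,y)=\frac{\rho_1^{1-\alpha_1}\rho_2^{1-\alpha_2}}{\Gamma(\alpha_1)\Gamma(\alpha_2)}\int_0^x\!\!\int_0^y\frac{s^{\rho_1-1}t^{\rho_2-1}}{(x^{\rho_1}-s^{\rho_1})^{1-\alpha_1}(y^{\rho_2}-t^{\rho_2})^{1-\alpha_2}}\,u(s,t)\,dt\,ds ,$$ applied to the end points of the level sets when $u$ is fuzzy-valued; an integral of order $0$ in one of the variables is the identity in that variable. The Caputo–Katugampola gH-derivative of $\upsilon$ on $\Omega$ is $${}^C\mathfrak D^{\varphi,\rho}_{0^+}\upsilon(x,y)=x^{1-\rho_1}y^{1-\rho_2}\,\frac{\partial^2}{\partial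 x\,\partial y}\,\mathfrak I^{1-\varphi,\rho}_{0^+}w(x,y),\qquad w(x,y)=\upsilon(x,y)\ominus\upsilon(x,0)\ominus\upsilon(0,y)+\upsilon(0,0),$$ where $w$ is the $\hat E_f$-valued function with $\upsilon(x,y)+\upsilon(0,0)=\upsilon(x,0)+\upsilon(0,y)+w(x,y)$ on $\overline\Omega$, and where $\mathcal U=\mathfrak I^{1-\varphi,\rho}_{0^+}w$ has a mixed gH-derivative (first in $x$, then in $y$) without switching points: $\mathcal U$ and $\partial\mathcal U/\partial x$ are continuous on $\Omega$, the type of $\mathcal U$ with respect to $x$ is the same, (i) or (ii), at all points of $\Omega$, and so is the type of $\partial\mathcal U/\partial x$ with respect to $y$ (the two types may differ). **Theorem.** Let $\mathcal F:\Omega\times\hat E_f\to\hat E_f$ be continuous, with $\{\mathcal F(x,y,\mathfrak z):(x,y)\in\Omega\}$ bounded in $(\hat E_f,\mathbb D)$ for every $\mathfrak z\in\hat E_f$. Let $\xi_1:[0,a]\to\hat E_f$ and $\xi_2:[0,b]\to\hat E_f$ be continuous with $\xi_1(0)=\xi_2(0)$, and suppose that $h(x,y)=\big(\xi_1(x)+\xi_2(y)\big)\ominus\xi_1(0)$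 exists in $\hat E_f$ for all $(x,y)\in\overline\Omega$. Suppose there is $R>0$ with $$\mathbb D\big(\mathcal F(x,y,\mathfrak u),\mathcal F(x,y,\hat{\mathfrak u})\big)\le R\,\mathbb D(\mathfrak u,\hat{\mathfrak u})\qquad\text{for all }(x,y)\in\Omega,\ \mathfrak u,\hat{\mathfrak u}\in\hat E_f,$$ and $$\Xi=\frac{R}{\Gamma(\varphi_1+1)\Gamma(\varphi_2+1)}\Big(\frac{a^{\rho_1}}{\rho_1}\Big)^{\varphi_1}\Big(\frac{b^{\rho_2}}{\rho_2}\Big)^{\varphi_2}<1 .$$ Then the Darboux problem $${}^C\mathfrak D^{\varphi,\rho}_{0^+}\upsilon(x,y)=\mathcal F(x,y,\upsilon(x,y))\ \text{ on }\Omega,\qquad \upsilon(x,0)=\xi_1(x),\quad \upsilon(0,y)=\xi_2(y)$$ has exactly one solution $\upsilon\in C(\overline\Omega,\hat E_f)$. This $\upsilon$ is also the unique $\upsilon\in C(\overline\Omega,\hat E_f)$ with $$\upsilon(x,y)=h(x,y)+\mathfrak I^{\varphi,\rho}_{0^+}\big[\mathcal F(x,y,\upsilon(x,y))\big]\qquad\text{for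 all }(x,y)\in\overline\Omega .$$ -/

import Mathlib

open Set Filter Topology
open scoped Pointwise

/-- A fuzzy number: a normal, fuzzy-convex, upper semicontinuous, compactly supported map
`ℝ → [0,1]`. -/
@[ext]
structure FuzzyNumber where
  mem : ℝ → ℝ
  mem_nonneg : ∀ x, 0 ≤ mem x
  mem_le_one : ∀ x, mem x ≤ 1
  normal : ∃ x, mem x = 1
  fuzzyConvex : ∀ x₁ x₂ t : ℝ, 0 ≤ t → t ≤ 1 →
    min (mem x₁) (mem x₂) ≤ mem (t * x₁ + (1 - t) * x₂)
  upperSemicontinuous : UpperSemicontinuous mem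
  compactSupport : IsCompact (closure {x | 0 < mem x})

namespace FuzzyNumber

/-- The `r`-level set: `{x | r ≤ z x}` for `0 < r ≤ 1`, the closure of `{x | 0 < z x}` for
`r = 0`. -/
def level (z : FuzzyNumber) (r : ℝ) : Set ℝ :=
  if r = 0 then closure {x | 0 < z.mem x} else {x | r ≤ z.mem x}

/-- Left end point of the `r`-level set. -/
noncomputable def lower (z : FuzzyNumber) (r : ℝ) : ℝ := sInf (z.level r)

/-- Right end point of the `r`-level set. -/
noncomputable def upper (z : FuzzyNumber) (r : ℝ) : ℝ := sSup (z.level r)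

theorem level_subset (z : FuzzyNumber) {r : ℝ} (hr : r ∈ Icc (0 : ℝ) 1) :
    z.level r ⊆ z.level 0 := by
  by_cases h : r = 0
  · rw [h]
  · have hpos : 0 < r := lt_of_le_of_ne hr.1 (Ne.symm h)
    intro x hx
    simp only [level, h, if_false, if_true, mem_ofPred_eq] at hx ⊢
    exact subset_closure (lt_of_lt_of_le hpos hx)

theorem isCompact_level (z : FuzzyNumber) {r : ℝ} (hr : r ∈ Icc (0 : ℝ) 1) :
    IsCompact (z.level r) := by
  have h0 : IsCompact (z.level 0) := by simpa [level] using z.compactSupport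
  refine h0.of_isClosed_subset ?_ (z.level_subset hr)
  by_cases h : r = 0
  · simp [level, h]
  · simp only [level, h, if_false]
    exact z.upperSemicontinuous.isClosed_preimage r

theorem nonempty_level (z : FuzzyNumber) {r : ℝ} (hr : r ∈ Icc (0 : ℝ) 1) :
    (z.level r).Nonempty := by
  obtain ⟨x, hx⟩ := z.normal
  refine ⟨x, ?_⟩
  by_cases h : r = 0
  · simp only [level, h, if_true]
    exact subset_closure (by simp [hx])
  · simp only [level, h, if_false, mem_ofPred_eq, hx]
    exact hr.2

theorem lower_le_upper (z : FuzzyNumber) {r : ℝ} (hr : r ∈ Icc (0 : ℝ) 1) :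
    z.lower r ≤ z.upper r := by
  obtain ⟨x, hx⟩ := z.nonempty_level hr
  exact (csInf_le (z.isCompact_level hr).bddBelow hx).trans
    (le_csSup (z.isCompact_level hr).bddAbove hx)

theorem lower_zero_le (z : FuzzyNumber) {r : ℝ} (hr : r ∈ Icc (0 : ℝ) 1) :
    z.lower 0 ≤ z.lower r :=
  csInf_le_csInf (z.isCompact_level (by simp)).bddBelow (z.nonempty_level hr) (z.level_subset hr)

theorem upper_le_zero (z : FuzzyNumber) {r : ℝ} (hr : r ∈ Icc (0 : ℝ) 1) :
    z.upper r ≤ z.upper 0 :=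
  csSup_le_csSup (z.isCompact_level (by simp)).bddAbove (z.nonempty_level hr) (z.level_subset hr)

theorem level_eq_Icc (z : FuzzyNumber) {r : ℝ} (hr : r ∈ Ioc (0 : ℝ) 1) :
    z.level r = Icc (z.lower r) (z.upper r) := by
  have hr' : r ∈ Icc (0 : ℝ) 1 := ⟨hr.1.le, hr.2⟩
  have hK := z.isCompact_level hr'
  have hne := z.nonempty_level hr'
  refine eq_Icc_of_connected_compact ⟨hne, Convex.isPreconnected ?_⟩ hK
  have h : r ≠ 0 := hr.1.ne'
  intro x hx y hy s t hs ht hst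
  simp only [level, h, if_false, mem_ofPred_eq, smul_eq_mul] at hx hy ⊢
  have := z.fuzzyConvex x y s hs (by linarith)
  rw [show 1 - s = t by linarith] at this
  exact (le_min hx hy).trans this

/-- The Hausdorff distance `max {|p̲ᵣ - q̲ᵣ|, |p̅ᵣ - q̅ᵣ|}` of the `r`-level intervals. -/
noncomputable def levelDist (p q : FuzzyNumber) (r : ℝ) : ℝ :=
  max |p.lower r - q.lower r| |p.upper r - q.upper r|

/-- The supremum `𝔻(p, q)` over `r ∈ [0,1]` of the Hausdorff distances of the level sets. -/
noncomputable def D (p q : FuzzyNumber) : ℝ :=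
  ⨆ r : Icc (0 : ℝ) 1, levelDist p q r

theorem bddAbove_levelDist (p q : FuzzyNumber) :
    BddAbove (range fun r : Icc (0 : ℝ) 1 => levelDist p q r) := by
  refine ⟨|p.lower 0| + |p.upper 0| + |q.lower 0| + |q.upper 0|, ?_⟩
  rintro _ ⟨r, rfl⟩
  have h1 := p.lower_le_upper r.2
  have h2 := q.lower_le_upper r.2
  have h3 := p.lower_zero_le r.2
  have h4 := q.lower_zero_le r.2
  have h5 := p.upper_le_zero r.2
  have h6 := q.upper_le_zero r.2
  have a1 := neg_abs_le (p.lower 0)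
  have a2 := le_abs_self (p.upper 0)
  have a3 := neg_abs_le (q.lower 0)
  have a4 := le_abs_self (q.upper 0)
  have n1 := abs_nonneg (p.lower 0)
  have n2 := abs_nonneg (p.upper 0)
  have n3 := abs_nonneg (q.lower 0)
  have n4 := abs_nonneg (q.upper 0)
  refine max_le (abs_le.2 ⟨?_, ?_⟩) (abs_le.2 ⟨?_, ?_⟩) <;> linarith

theorem levelDist_le_D (p q : FuzzyNumber) {r : ℝ} (hr : r ∈ Icc (0 : ℝ) 1) :
    levelDist p q r ≤ D p q :=
  le_ciSup (bddAbove_levelDist p q) (⟨r, hr⟩ : Icc (0 : ℝ) 1)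

theorem eq_of_D_eq_zero {p q : FuzzyNumber} (h : D p q = 0) : p = q := by
  have key : ∀ r ∈ Ioc (0 : ℝ) 1, p.level r = q.level r := by
    intro r hr
    have h1 := levelDist_le_D p q (r := r) ⟨hr.1.le, hr.2⟩
    rw [h] at h1
    have h2 : |p.lower r - q.lower r| ≤ 0 := (le_max_left _ _).trans h1
    have h3 : |p.upper r - q.upper r| ≤ 0 := (le_max_right _ _).trans h1
    rw [level_eq_Icc p hr, level_eq_Icc q hr, sub_eq_zero.1 (abs_nonpos_iff.1 h2),
      sub_eq_zero.1 (abs_nonpos_iff.1 h3)]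
  have le : ∀ u v : FuzzyNumber, (∀ r ∈ Ioc (0 : ℝ) 1, u.level r = v.level r) →
      ∀ x, u.mem x ≤ v.mem x := by
    intro u v huv x
    rcases (u.mem_nonneg x).eq_or_lt with h0 | h0
    · rw [← h0]; exact v.mem_nonneg x
    · have hx : x ∈ u.level (u.mem x) := by simp [level, h0.ne']
      rw [huv _ ⟨h0, u.mem_le_one x⟩] at hx
      simpa [level, h0.ne'] using hx
  ext x
  exact le_antisymm (le p q key x) (le q p (fun r hr => (key r hr).symm) x)

/-- The space of fuzzy numbers with the metric `𝔻`. -/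
noncomputable instance : MetricSpace FuzzyNumber where
  dist := D
  dist_self p := by simp [D, levelDist]
  dist_comm p q := by
    simp only [D, levelDist, abs_sub_comm]
  dist_triangle p q s := by
    have : Nonempty (Icc (0 : ℝ) 1) := ⟨⟨0, by simp⟩⟩
    refine ciSup_le fun r => ?_
    have h1 := levelDist_le_D p q r.2
    have h2 := levelDist_le_D q s r.2
    refine le_trans (max_le ?_ ?_) (add_le_add h1 h2)
    · exact (abs_sub_le _ (q.lower r) _).trans (add_le_add (le_max_left _ _) (le_max_left _ _))
    · exact (abs_sub_le _ (q.upper r) _).trans (add_le_add (le_max_right _ _) (le_max_right _ _))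
  eq_of_dist_eq_zero := eq_of_D_eq_zero

end FuzzyNumber

/-- The metric space `Ê` of fuzzy numbers `z` for which `r ↦ [z]ʳ` is continuous on `[0,1]` for
the Hausdorff metric, that is, both end points are continuous in `r`. Its distance is `𝔻`. -/
abbrev FuzzyHat : Type :=
  {z : FuzzyNumber // ContinuousOn z.lower (Icc 0 1) ∧ ContinuousOn z.upper (Icc 0 1)}

namespace FuzzyHat

/-- `r`-level set. -/
def level (z : FuzzyHat) (r : ℝ) : Set ℝ := z.1.level r

/-- Left end point of the `r`-level set. -/
noncomputable def lower (z : FuzzyHat) (r : ℝ) : ℝ := z.1.lower r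

/-- Right end point of the `r`-level set. -/
noncomputable def upper (z : FuzzyHat) (r : ℝ) : ℝ := z.1.upper r

/-- `p = q + w`, the level sets being added as Minkowski sums; equivalently, `w` is the Hukuhara
difference `p ⊖ q`. -/
def IsSum (p q w : FuzzyHat) : Prop :=
  ∀ r ∈ Icc (0 : ℝ) 1, p.level r = q.level r + w.level r

/-- `p + p' = q + q' `. -/
def SumsEq (p p' q q' : FuzzyHat) : Prop :=
  ∀ r ∈ Icc (0 : ℝ) 1, p.level r + p'.level r = q.level r + q'.level r

/-- `p = c • q`, by level sets. -/
def IsSMul (p : FuzzyHat) (c : ℝ) (q : FuzzyHat) : Prop :=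
  ∀ r ∈ Icc (0 : ℝ) 1, p.level r = c • q.level r

/-- `w` is the generalized Hukuhara difference of `p` and `q`:
`p = q + w` or `q = p + (-1) w`. -/
def IsGHDiff (p q w : FuzzyHat) : Prop :=
  (∀ r ∈ Icc (0 : ℝ) 1, p.level r = q.level r + w.level r) ∨
    (∀ r ∈ Icc (0 : ℝ) 1, q.level r = p.level r + (-1 : ℝ) • w.level r)

/-- `v` is the generalized Hukuhara derivative of `u` at `x`, relative to `S`: near `x` the
difference quotients `q t = (t - x)⁻¹ (u t ⊖ u x)` exist in `Ê`, and they tend to `v`. -/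
def HasGHDerivWithin (u : ℝ → FuzzyHat) (v : FuzzyHat) (S : Set ℝ) (x : ℝ) : Prop :=
  ∃ q : ℝ → FuzzyHat,
    (∀ᶠ t in 𝓝[S \ {x}] x, ∃ d, IsGHDiff (u t) (u x) d ∧ IsSMul (q t) (t - x)⁻¹ d) ∧
    Tendsto q (𝓝[S \ {x}] x) (𝓝 v)

/-- The two types of generalized Hukuhara differentiability. -/
inductive GHType
  | i
  | ii

/-- `v` is the generalized Hukuhara derivative of `u` at `x` (relative to `S`), of the given type:
`[v]ʳ = [(u̲ᵣ)', (u̅ᵣ)']` for type (i) and `[v]ʳ = [(u̅ᵣ)', (u̲ᵣ)']` for type (ii). -/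
def HasGHDerivOfType (T : GHType) (u : ℝ → FuzzyHat) (v : FuzzyHat) (S : Set ℝ) (x : ℝ) : Prop :=
  HasGHDerivWithin u v S x ∧
  match T with
  | GHType.i => ∀ r ∈ Icc (0 : ℝ) 1,
      HasDerivWithinAt (fun t => (u t).lower r) (v.lower r) S x ∧
      HasDerivWithinAt (fun t => (u t).upper r) (v.upper r) S x
  | GHType.ii => ∀ r ∈ Icc (0 : ℝ) 1,
      HasDerivWithinAt (fun t => (u t).upper r) (v.lower r) S x ∧
      HasDerivWithinAt (fun t => (u t).lower r) (v.upper r) S x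

/-- `Q` is the mixed second order gH-partial derivative `∂²U/∂x∂y` on `Ω = (0,a] × (0,b]`, without
switching points: `U` and `∂U/∂x` are continuous on `Ω`, and the type of `U` with respect to `x`
and the type of `∂U/∂x` with respect to `y` are constant on `Ω`. -/
def HasMixedGHDeriv (a b : ℝ) (U Q : ℝ → ℝ → FuzzyHat) : Prop :=
  ∃ (P : ℝ → ℝ → FuzzyHat) (T₁ T₂ : GHType),
    ContinuousOn (fun q : ℝ × ℝ => U q.1 q.2) (Ioc 0 a ×ˢ Ioc 0 b) ∧
    ContinuousOn (fun q : ℝ × ℝ => P q.1 q.2) (Ioc 0 a ×ˢ Ioc 0 b) ∧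
    ∀ x ∈ Ioc 0 a, ∀ y ∈ Ioc 0 b,
      HasGHDerivOfType T₁ (fun s => U s y) (P x y) (Ioc 0 a) x ∧
      HasGHDerivOfType T₂ (fun t => P x t) (Q x y) (Ioc 0 b) y

end FuzzyHat

/-- The Katugampola fractional integral of order `α ≥ 0` in one real variable (the identity for
`α = 0`). -/
noncomputable def katInt₁ (α ρ : ℝ) (f : ℝ → ℝ) (x : ℝ) : ℝ :=
  if α = 0 then f x
  else ρ ^ (1 - α) / Real.Gamma α *
    ∫ s in (0 : ℝ)..x, s ^ (ρ - 1) / (x ^ ρ - s ^ ρ) ^ (1 - α) * f s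

/-- The mixed Katugampola fractional integral of order `(α₁, α₂)` of a real function of two
variables: the `x`-integral of the `y`-integral. -/
noncomputable def katInt (α₁ α₂ ρ₁ ρ₂ : ℝ) (f : ℝ → ℝ → ℝ) (x y : ℝ) : ℝ :=
  katInt₁ α₁ ρ₁ (fun s => katInt₁ α₂ ρ₂ (fun t => f s t) y) x

namespace FuzzyHat

/-- `J` is the value at `(x, y)` of the mixed Katugampola fuzzy fractional integral of `u`: its
level sets are `[I u̲ᵣ, I u̅ᵣ]`. -/
def IsKatInt (α₁ α₂ ρ₁ ρ₂ : ℝ) (u : ℝ → ℝ → FuzzyHat) (x y : ℝ) (J : FuzzyHat) : Prop :=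
  ∀ r ∈ Icc (0 : ℝ) 1,
    J.lower r = katInt α₁ α₂ ρ₁ ρ₂ (fun s t => (u s t).lower r) x y ∧
    J.upper r = katInt α₁ α₂ ρ₁ ρ₂ (fun s t => (u s t).upper r) x y

/-- `V` is the mixed fuzzy Katugampola gH-fractional derivative
`x^(1-ρ₁) y^(1-ρ₂) ∂²/∂x∂y (I^(1-φ) w)` of `w` on `(0,a] × (0,b]`. -/
def HasKatDeriv (φ₁ φ₂ ρ₁ ρ₂ a b : ℝ) (w V : ℝ → ℝ → FuzzyHat) : Prop :=
  ∃ U Q : ℝ → ℝ → FuzzyHat,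
    (∀ x ∈ Icc 0 a, ∀ y ∈ Icc 0 b, IsKatInt (1 - φ₁) (1 - φ₂) ρ₁ ρ₂ w x y (U x y)) ∧
    HasMixedGHDeriv a b U Q ∧
    ∀ x ∈ Ioc 0 a, ∀ y ∈ Ioc 0 b, IsSMul (V x y) (x ^ (1 - ρ₁) * y ^ (1 - ρ₂)) (Q x y)

/-- `V` is the mixed fuzzy Caputo–Katugampola gH-fractional derivative of `v` on `(0,a] × (0,b]`:
the Katugampola derivative of `w(x,y) = v(x,y) ⊖ v(x,0) ⊖ v(0,y) + v(0,0)`, which stands for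
`v(x,y) + v(0,0) = v(x,0) + v(0,y) + w(x,y)`. -/
def HasCKDeriv (φ₁ φ₂ ρ₁ ρ₂ a b : ℝ) (v V : ℝ → ℝ → FuzzyHat) : Prop :=
  ∃ w : ℝ → ℝ → FuzzyHat,
    (∀ x ∈ Icc 0 a, ∀ y ∈ Icc 0 b, ∀ r ∈ Icc (0 : ℝ) 1,
      (v x y).level r + (v 0 0).level r =
        (v x 0).level r + (v 0 y).level r + (w x y).level r) ∧
    HasKatDeriv φ₁ φ₂ ρ₁ ρ₂ a b w V

/-- `v ∈ C([0,a] × [0,b], Ê)` solves the Darboux problem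
`ᶜD v = F(x, y, v)` on `(0,a] × (0,b]`, `v(x,0) = ξ₁(x)`, `v(0,y) = ξ₂(y)`. -/
def IsDarbouxSolution (φ₁ φ₂ ρ₁ ρ₂ a b : ℝ) (F : ℝ → ℝ → FuzzyHat → FuzzyHat)
    (ξ₁ ξ₂ : ℝ → FuzzyHat) (v : ℝ → ℝ → FuzzyHat) : Prop :=
  ContinuousOn (fun q : ℝ × ℝ => v q.1 q.2) (Icc 0 a ×ˢ Icc 0 b) ∧
  (∀ x ∈ Icc 0 a, v x 0 = ξ₁ x) ∧ (∀ y ∈ Icc 0 b, v 0 y = ξ₂ y) ∧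
  HasCKDeriv φ₁ φ₂ ρ₁ ρ₂ a b v (fun x y => F x y (v x y))

/-- `v ∈ C([0,a] × [0,b], Ê)` solves the integral equation `v = h + I^φ F(x, y, v)`, where
`h(x,y) = (ξ₁(x) + ξ₂(y)) ⊖ ξ₁(0)`. -/
def IsIntegralSolution (φ₁ φ₂ ρ₁ ρ₂ a b : ℝ) (F : ℝ → ℝ → FuzzyHat → FuzzyHat)
    (ξ₁ ξ₂ : ℝ → FuzzyHat) (v : ℝ → ℝ → FuzzyHat) : Prop :=
  ContinuousOn (fun q : ℝ × ℝ => v q.1 q.2) (Icc 0 a ×ˢ Icc 0 b) ∧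
  ∀ x ∈ Icc 0 a, ∀ y ∈ Icc 0 b, ∃ h J : FuzzyHat,
    SumsEq (ξ₁ x) (ξ₂ y) (ξ₁ 0) h ∧
    IsKatInt φ₁ φ₂ ρ₁ ρ₂ (fun s t => F s t (v s t)) x y J ∧
    IsSum (v x y) h J

end FuzzyHat

/-! The map `emb` sends a fuzzy number to its pair of end-point functions. It is an isometry onto a
closed convex cone in the Banach space `C[0,1] × C[0,1]` (`dist_emb`, `range_emb`), so `Ê` is
complete. Relations between level sets become linear identities (`isSum_iff`, `sumsEq_iff`), and a
Hukuhara difference exists exactly when the vector difference lies in the cone. Integration against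
a nonnegative kernel preserves the cone, so the integral equation becomes `v = ξ₁ + ξ₂ - ξ₁(0) + I^φ
F(v)` in a Banach space. The quantity `Ξ` is the Lipschitz constant of its right-hand side, and
Banach's theorem gives the unique solution (`exists_unique_solvesEmbEq`).

It remains to match this equation with the Darboux problem. Put `G = F(v)`, and let `w` be `v`
corrected to vanish on the axes. If `w = I^φ G`, then the semigroup law gives `I^{1-φ} w = I^1 G`.
This is a weighted double primitive whose increments lie in the cone, so it has a mixed
gH-derivative of types (i), (i) (`hasKatDeriv_of_emb_eq`).

Conversely, let `U = I^{1-φ} w` have the prescribed mixed derivative. If the two types agree, each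
end point of `U` is the `I^1` of the same end point of `G`. If they differ, the end points are
crossed: the lower one of `U` is `I^1` of the upper one of `G`, and vice versa. But `I^1` is
monotone and the end points of `U` are ordered, so both are equal and `U = I^1 G` holds again
(`emb_eq_katInt2_of_hasMixedGHDeriv`). Thus `I^{1-φ} w = I^{1-φ} I^φ G`, and injectivity of
`I^{1-φ}` gives `w = I^φ G` (`HasKatDeriv.emb_eq_katInt2`). -/

open MeasureTheory

/-! ### Level sets as nested compact intervals, including level 0 -/

namespace FuzzyNumber

theorem level_eq_Icc_of_mem (z : FuzzyNumber) {r : ℝ} (hr : r ∈ Icc (0 : ℝ) 1) :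
    z.level r = Icc (z.lower r) (z.upper r) := by
  rcases hr.1.eq_or_lt with h | h
  · subst h
    refine eq_Icc_of_connected_compact ⟨z.nonempty_level hr, Convex.isPreconnected ?_⟩
      (z.isCompact_level hr)
    simp only [level, if_true]
    refine Convex.closure ?_
    intro x hx y hy s t hs ht hst
    have := z.fuzzyConvex x y s hs (by linarith)
    rw [show 1 - s = t by linarith] at this
    exact (lt_min hx hy).trans_le this
  · exact z.level_eq_Icc ⟨h, hr.2⟩

theorem level_anti (z : FuzzyNumber) {r r' : ℝ} (hr : 0 ≤ r) (hr' : r' ≤ 1) (h : r ≤ r') :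
    z.level r' ⊆ z.level r := by
  rcases hr.eq_or_lt with h0 | h0
  · rw [← h0]; exact z.level_subset ⟨hr.trans h, hr'⟩
  · intro x hx
    simp only [level, h0.ne', (h0.trans_le h).ne', if_false, mem_ofPred_eq] at hx ⊢
    exact h.trans hx

theorem lower_mono (z : FuzzyNumber) {r r' : ℝ} (hr : 0 ≤ r) (hr' : r' ≤ 1) (h : r ≤ r') :
    z.lower r ≤ z.lower r' :=
  csInf_le_csInf (z.isCompact_level ⟨hr, h.trans hr'⟩).bddBelow
    (z.nonempty_level ⟨hr.trans h, hr'⟩) (z.level_anti hr hr' h)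

theorem upper_anti (z : FuzzyNumber) {r r' : ℝ} (hr : 0 ≤ r) (hr' : r' ≤ 1) (h : r ≤ r') :
    z.upper r' ≤ z.upper r :=
  csSup_le_csSup (z.isCompact_level ⟨hr, h.trans hr'⟩).bddAbove
    (z.nonempty_level ⟨hr.trans h, hr'⟩) (z.level_anti hr hr' h)

end FuzzyNumber

/-! ### The cone of end-point pairs and the isometric embedding -/

/-- Pairs of continuous functions on `[0,1]`, the ambient Banach space for pairs of end points. -/
abbrev EndPts : Type := C(Icc (0 : ℝ) 1, ℝ) × C(Icc (0 : ℝ) 1, ℝ)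

namespace EndPts

/-- The closed convex cone of the pairs that are the end points of a fuzzy number. -/
def IsFuzzy (e : EndPts) : Prop :=
  Monotone e.1 ∧ Antitone e.2 ∧ e.1 1 ≤ e.2 1

/-- Evaluation of the lower end point. -/
noncomputable def lowerL (r : Icc (0 : ℝ) 1) : EndPts →L[ℝ] ℝ :=
  (ContinuousMap.evalCLM ℝ r).comp (ContinuousLinearMap.fst ℝ _ _)

/-- Evaluation of the upper end point. -/
noncomputable def upperL (r : Icc (0 : ℝ) 1) : EndPts →L[ℝ] ℝ :=
  (ContinuousMap.evalCLM ℝ r).comp (ContinuousLinearMap.snd ℝ _ _)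

@[simp] theorem lowerL_apply (r : Icc (0 : ℝ) 1) (e : EndPts) : lowerL r e = e.1 r := rfl

@[simp] theorem upperL_apply (r : Icc (0 : ℝ) 1) (e : EndPts) : upperL r e = e.2 r := rfl

/-- Membership in the cone is nonnegativity of a family of continuous linear functionals. In this
form both closedness and stability under Bochner integrals are immediate. -/
theorem isFuzzy_iff (e : EndPts) :
    IsFuzzy e ↔ (∀ r r', r ≤ r' → 0 ≤ (lowerL r' - lowerL r) e) ∧
      (∀ r r', r ≤ r' → 0 ≤ (upperL r - upperL r') e) ∧ 0 ≤ (upperL 1 - lowerL 1) e := by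
  simp [IsFuzzy, Monotone, Antitone]

theorem isClosed_isFuzzy : IsClosed {e | IsFuzzy e} := by
  simp only [isFuzzy_iff, ofPred_and, ofPred_forall]
  refine IsClosed.inter ?_ (IsClosed.inter ?_ ?_)
  · exact isClosed_iInter fun r => isClosed_iInter fun r' => isClosed_iInter fun _ =>
      isClosed_le continuous_const (ContinuousLinearMap.continuous _)
  · exact isClosed_iInter fun r => isClosed_iInter fun r' => isClosed_iInter fun _ =>
      isClosed_le continuous_const (ContinuousLinearMap.continuous _)
  · exact isClosed_le continuous_const (ContinuousLinearMap.continuous _)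

theorem IsFuzzy.add {e e' : EndPts} (h : IsFuzzy e) (h' : IsFuzzy e') : IsFuzzy (e + e') :=
  ⟨h.1.add h'.1, h.2.1.add h'.2.1, add_le_add h.2.2 h'.2.2⟩

theorem IsFuzzy.smul {e : EndPts} (h : IsFuzzy e) {c : ℝ} (hc : 0 ≤ c) : IsFuzzy (c • e) :=
  ⟨fun _ _ hr => mul_le_mul_of_nonneg_left (h.1 hr) hc,
    fun _ _ hr => mul_le_mul_of_nonneg_left (h.2.1 hr) hc,
    mul_le_mul_of_nonneg_left h.2.2 hc⟩

theorem isFuzzy_zero : IsFuzzy 0 :=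
  ⟨fun _ _ _ => le_rfl, fun _ _ _ => le_rfl, le_rfl⟩

theorem IsFuzzy.le {e : EndPts} (h : IsFuzzy e) (r : Icc (0 : ℝ) 1) : e.1 r ≤ e.2 r :=
  (h.1 r.2.2).trans (h.2.2.trans (h.2.1 r.2.2))

theorem apply_setIntegral_nonneg {E : Type*} [NormedAddCommGroup E] [NormedSpace ℝ E]
    [CompleteSpace E] (L : E →L[ℝ] ℝ) {f : ℝ → E} {s : Set ℝ} (hs : MeasurableSet s)
    (h : ∀ t ∈ s, 0 ≤ L (f t)) : 0 ≤ L (∫ t in s, f t) := by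
  by_cases hf : IntegrableOn f s
  · rw [← L.integral_comp_comm hf]
    exact setIntegral_nonneg hs h
  -- The integral of a non-integrable function is `0` by convention, so no integrability hypothesis
  -- is needed.
  · rw [integral_undef hf, map_zero]

theorem IsFuzzy.setIntegral {f : ℝ → EndPts} {s : Set ℝ} (hs : MeasurableSet s)
    (h : ∀ t ∈ s, IsFuzzy (f t)) : IsFuzzy (∫ t in s, f t) := by
  simp only [isFuzzy_iff] at h
  rw [isFuzzy_iff]
  exact ⟨fun r r' hr => apply_setIntegral_nonneg _ hs fun t ht => (h t ht).1 r r' hr,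
    fun r r' hr => apply_setIntegral_nonneg _ hs fun t ht => (h t ht).2.1 r r' hr,
    apply_setIntegral_nonneg _ hs fun t ht => (h t ht).2.2⟩

theorem IsFuzzy.intervalIntegral {f : ℝ → EndPts} {x y : ℝ} (hxy : x ≤ y)
    (h : ∀ t ∈ Ioc x y, IsFuzzy (f t)) : IsFuzzy (∫ t in x..y, f t) := by
  rw [intervalIntegral.integral_of_le hxy]
  exact IsFuzzy.setIntegral measurableSet_Ioc h

end EndPts

namespace FuzzyHat

open EndPts

/-- The pair of end points of a fuzzy number. -/
noncomputable def emb (z : FuzzyHat) : EndPts :=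
  (⟨fun r => z.lower r, continuousOn_iff_continuous_domRestrict.1 z.2.1⟩,
    ⟨fun r => z.upper r, continuousOn_iff_continuous_domRestrict.1 z.2.2⟩)

@[simp] theorem emb_fst (z : FuzzyHat) (r : Icc (0 : ℝ) 1) : (emb z).1 r = z.lower r := rfl

@[simp] theorem emb_snd (z : FuzzyHat) (r : Icc (0 : ℝ) 1) : (emb z).2 r = z.upper r := rfl

/-- The product norm is a maximum of two suprema over `r`, while `𝔻` is the supremum of a maximum;
the two operations commute. -/
theorem dist_emb (p q : FuzzyHat) : dist (emb p) (emb q) = dist p q := by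
  have hne : Nonempty (Icc (0 : ℝ) 1) := ⟨0⟩
  change _ = FuzzyNumber.D p.1 q.1
  apply le_antisymm
  · have h0 : 0 ≤ FuzzyNumber.D p.1 q.1 := dist_nonneg (x := p.1)
    refine max_le ((ContinuousMap.dist_le h0).2 fun r => ?_)
      ((ContinuousMap.dist_le h0).2 fun r => ?_)
    · exact (le_max_left _ _).trans (FuzzyNumber.levelDist_le_D p.1 q.1 r.2)
    · exact (le_max_right _ _).trans (FuzzyNumber.levelDist_le_D p.1 q.1 r.2)
  · refine ciSup_le fun r => max_le ?_ ?_
    · exact (ContinuousMap.dist_apply_le_dist (f := (emb p).1) (g := (emb q).1) r).trans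
        (le_max_left _ _)
    · exact (ContinuousMap.dist_apply_le_dist (f := (emb p).2) (g := (emb q).2) r).trans
        (le_max_right _ _)

theorem isometry_emb : Isometry emb := Isometry.of_dist_eq dist_emb

theorem isFuzzy_emb (z : FuzzyHat) : IsFuzzy (emb z) :=
  ⟨fun r r' h => z.1.lower_mono r.2.1 r'.2.2 h, fun r r' h => z.1.upper_anti r.2.1 r'.2.2 h,
    z.1.lower_le_upper (by simp)⟩

theorem level_eq (z : FuzzyHat) {r : ℝ} (hr : r ∈ Icc (0 : ℝ) 1) :
    z.level r = Icc (z.lower r) (z.upper r) := z.1.level_eq_Icc_of_mem hr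

theorem lower_le_upper (z : FuzzyHat) {r : ℝ} (hr : r ∈ Icc (0 : ℝ) 1) :
    z.lower r ≤ z.upper r := z.1.lower_le_upper hr

end FuzzyHat

/-! ### Reconstruction of a fuzzy number from its end points -/

namespace EndPts

/-- The membership function of the fuzzy number with prescribed end points. -/
noncomputable def memFun (e : EndPts) (x : ℝ) : ℝ :=
  sSup ((fun r : Icc (0 : ℝ) 1 => (r : ℝ)) '' {r | r = 0 ∨ (e.1 r ≤ x ∧ x ≤ e.2 r)})

/-- Compactness makes the supremum in `memFun` attained. The index `0` always belongs to the set, so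
it is never empty, and off the support the value is `0`. -/
theorem memFun_set_compact (e : EndPts) (x : ℝ) :
    IsCompact ((fun r : Icc (0 : ℝ) 1 => (r : ℝ)) '' {r | r = 0 ∨ (e.1 r ≤ x ∧ x ≤ e.2 r)}) := by
  refine IsCompact.image (IsClosed.isCompact ?_) continuous_subtype_val
  exact (isClosed_singleton (x := (0 : Icc (0 : ℝ) 1))).union
    ((isClosed_le e.1.continuous continuous_const).inter
      (isClosed_le continuous_const e.2.continuous))

theorem memFun_mem (e : EndPts) (x : ℝ) :
    e.memFun x ∈ (fun r : Icc (0 : ℝ) 1 => (r : ℝ)) '' {r | r = 0 ∨ (e.1 r ≤ x ∧ x ≤ e.2 r)} :=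
  (e.memFun_set_compact x).sSup_mem ⟨0, 0, Or.inl rfl, rfl⟩

/-- The supremum is attained at some level, and the intervals are nested. Positivity of `r` excludes
the index `0` that was added by hand. -/
theorem le_memFun_iff {e : EndPts} (he : IsFuzzy e) (r : Icc (0 : ℝ) 1) (hr : 0 < (r : ℝ))
    (x : ℝ) : (r : ℝ) ≤ e.memFun x ↔ e.1 r ≤ x ∧ x ≤ e.2 r := by
  constructor
  · intro h
    obtain ⟨r', h1, h2⟩ := e.memFun_mem x
    simp only at h2
    rw [← h2] at h
    rcases h1 with h1 | h1
    · subst h1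
      exact absurd hr (not_lt.2 h)
    · exact ⟨(he.1 h).trans h1.1, h1.2.trans (he.2.1 h)⟩
  · intro h
    exact le_csSup (e.memFun_set_compact x).bddAbove ⟨r, Or.inr h, rfl⟩

theorem memFun_nonneg (e : EndPts) (x : ℝ) : 0 ≤ e.memFun x := by
  obtain ⟨r', _, h2⟩ := e.memFun_mem x
  rw [← h2]
  exact r'.2.1

theorem memFun_le_one (e : EndPts) (x : ℝ) : e.memFun x ≤ 1 := by
  obtain ⟨r', _, h2⟩ := e.memFun_mem x
  rw [← h2]
  exact r'.2.2

theorem closure_memFun_pos_subset {e : EndPts} (he : IsFuzzy e) :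
    closure {x | 0 < e.memFun x} ⊆ Icc (e.1 0) (e.2 0) := by
  refine closure_minimal (fun x hx => ?_) isClosed_Icc
  have := (le_memFun_iff he ⟨_, e.memFun_nonneg x, e.memFun_le_one x⟩ hx x).1 le_rfl
  exact ⟨(he.1 (e.memFun_nonneg x)).trans this.1, this.2.trans (he.2.1 (e.memFun_nonneg x))⟩

/-- The fuzzy number with prescribed end points. -/
noncomputable def toFuzzyNumber (e : EndPts) (he : IsFuzzy e) : FuzzyNumber where
  mem := e.memFun
  mem_nonneg := e.memFun_nonneg
  mem_le_one := e.memFun_le_one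
  normal := ⟨e.1 1, le_antisymm (e.memFun_le_one _)
    ((le_memFun_iff he 1 one_pos _).2 ⟨le_rfl, he.2.2⟩)⟩
  fuzzyConvex x₁ x₂ t h0 h1 := by
    rcases (le_min (e.memFun_nonneg x₁) (e.memFun_nonneg x₂)).eq_or_lt with h | h
    · rw [← h]
      exact e.memFun_nonneg _
    · set m := min (e.memFun x₁) (e.memFun x₂) with hm
      have hm1 : m ≤ 1 := (min_le_left _ _).trans (e.memFun_le_one _)
      have a1 := (le_memFun_iff he ⟨m, h.le, hm1⟩ h x₁).1 (min_le_left _ _)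
      have a2 := (le_memFun_iff he ⟨m, h.le, hm1⟩ h x₂).1 (min_le_right _ _)
      refine (le_memFun_iff he ⟨m, h.le, hm1⟩ h _).2 ⟨?_, ?_⟩
      · nlinarith [a1.1, a2.1]
      · nlinarith [a1.2, a2.2]
  upperSemicontinuous := by
    rw [upperSemicontinuous_iff_isClosed_preimage]
    intro r
    rcases le_or_gt r 0 with h | h
    · convert isClosed_univ
      exact eq_univ_of_forall fun x => h.trans (e.memFun_nonneg x)
    rcases le_or_gt r 1 with h1 | h1
    · convert isClosed_Icc (a := e.1 ⟨r, h.le, h1⟩) (b := e.2 ⟨r, h.le, h1⟩) using 1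
      ext x
      exact le_memFun_iff he ⟨r, h.le, h1⟩ h x
    · convert isClosed_empty
      refine eq_empty_of_forall_notMem fun x hx => ?_
      exact absurd (lt_of_lt_of_le h1 hx) (not_lt.2 (e.memFun_le_one x))
  compactSupport := isCompact_Icc.of_isClosed_subset isClosed_closure
    (closure_memFun_pos_subset he)

theorem toFuzzyNumber_level {e : EndPts} (he : IsFuzzy e) (r : Icc (0 : ℝ) 1) :
    (e.toFuzzyNumber he).level r = Icc (e.1 r) (e.2 r) := by
  have hpos : ∀ r : Icc (0 : ℝ) 1, 0 < (r : ℝ) →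
      (e.toFuzzyNumber he).level r = Icc (e.1 r) (e.2 r) := by
    intro r h
    ext x
    simp only [FuzzyNumber.level, h.ne', if_false]
    exact le_memFun_iff he r h x
  rcases r.2.1.eq_or_lt with h | h
  · have hr : r = 0 := Subtype.ext h.symm
    subst hr
    refine Subset.antisymm ?_ ?_
    · simp only [FuzzyNumber.level, Icc.coe_zero, if_true]
      exact closure_memFun_pos_subset he
    -- Level 0 contains every positive level; letting `r → 0` in the continuous end points yields
    -- the whole interval.
    · have hz : (0 : ℝ) ∈ Icc (0 : ℝ) 1 := by simp
      have hcl : (0 : Icc (0 : ℝ) 1) ∈ closure {r : Icc (0 : ℝ) 1 | 0 < (r : ℝ)} := by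
        have : {r : Icc (0 : ℝ) 1 | 0 < (r : ℝ)} = Ioi 0 := by
          rfl
        rw [this, closure_Ioi' ⟨1, zero_lt_one⟩]
        exact self_mem_Ici
      rw [Icc.coe_zero, FuzzyNumber.level_eq_Icc_of_mem _ hz]
      have key : ∀ r ∈ {r : Icc (0 : ℝ) 1 | 0 < (r : ℝ)},
          (e.toFuzzyNumber he).lower 0 ≤ e.1 r ∧ e.2 r ≤ (e.toFuzzyNumber he).upper 0 := by
        intro r hr
        have h1 := (e.toFuzzyNumber he).level_subset r.2
        rw [hpos r hr, FuzzyNumber.level_eq_Icc_of_mem _ hz] at h1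
        exact (Icc_subset_Icc_iff (he.le r)).1 h1
      have hc : IsClosed {r : Icc (0 : ℝ) 1 |
          (e.toFuzzyNumber he).lower 0 ≤ e.1 r ∧ e.2 r ≤ (e.toFuzzyNumber he).upper 0} :=
        (isClosed_le continuous_const e.1.continuous).inter
          (isClosed_le e.2.continuous continuous_const)
      have := closure_minimal key hc hcl
      exact Icc_subset_Icc this.1 this.2
  · exact hpos r h

theorem toFuzzyNumber_lower {e : EndPts} (he : IsFuzzy e) (r : Icc (0 : ℝ) 1) :
    (e.toFuzzyNumber he).lower r = e.1 r := by
  rw [FuzzyNumber.lower, toFuzzyNumber_level, csInf_Icc (he.le r)]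

theorem toFuzzyNumber_upper {e : EndPts} (he : IsFuzzy e) (r : Icc (0 : ℝ) 1) :
    (e.toFuzzyNumber he).upper r = e.2 r := by
  rw [FuzzyNumber.upper, toFuzzyNumber_level, csSup_Icc (he.le r)]

theorem IsFuzzy.exists_emb {e : EndPts} (he : IsFuzzy e) : ∃ z : FuzzyHat, z.emb = e := by
  refine ⟨⟨e.toFuzzyNumber he, ?_, ?_⟩, ?_⟩
  · rw [continuousOn_iff_continuous_domRestrict]
    exact e.1.continuous.congr fun r => (toFuzzyNumber_lower he r).symm
  · rw [continuousOn_iff_continuous_domRestrict]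
    exact e.2.continuous.congr fun r => (toFuzzyNumber_upper he r).symm
  · refine Prod.ext (ContinuousMap.ext fun r => ?_) (ContinuousMap.ext fun r => ?_)
    · exact toFuzzyNumber_lower he r
    · exact toFuzzyNumber_upper he r

end EndPts

/-! ### Completeness, and level-set relations as linear identities -/

namespace FuzzyHat

open EndPts

theorem range_emb : range emb = {e | IsFuzzy e} := by
  ext e
  exact ⟨by rintro ⟨z, rfl⟩; exact isFuzzy_emb z, fun h => h.exists_emb⟩

instance : CompleteSpace FuzzyHat := by
  refine isometry_emb.isUniformInducing.completeSpace ?_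
  rw [range_emb]
  exact isClosed_isFuzzy.isComplete

theorem emb_injective : Function.Injective emb := isometry_emb.injective

/-- The fuzzy number with the given end points (and a junk value outside the cone). -/
noncomputable def ofEndPts (e : EndPts) : FuzzyHat :=
  haveI : Nonempty FuzzyHat := ⟨isFuzzy_zero.exists_emb.choose⟩
  Function.invFun emb e

theorem emb_ofEndPts {e : EndPts} (he : IsFuzzy e) : emb (ofEndPts e) = e := by
  have : Nonempty FuzzyHat := ⟨isFuzzy_zero.exists_emb.choose⟩
  exact Function.invFun_eq he.exists_emb

instance : Nonempty FuzzyHat := ⟨ofEndPts 0⟩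

theorem Icc_add_Icc_eq {a b c d : ℝ} (h : a ≤ b) (h' : c ≤ d) :
    Icc a b + Icc c d = Icc (a + c) (b + d) := by
  refine Subset.antisymm ?_ fun x hx => ?_
  · rintro _ ⟨x, hx, y, hy, rfl⟩
    exact ⟨add_le_add hx.1 hy.1, add_le_add hx.2 hy.2⟩
  · refine ⟨max a (x - d), ⟨le_max_left _ _, max_le h (by linarith [hx.2])⟩,
      x - max a (x - d), ⟨?_, ?_⟩, by simp⟩
    · have : max a (x - d) ≤ x - c := max_le (by linarith [hx.1]) (by linarith)
      linarith
    · linarith [le_max_right a (x - d)]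

theorem Icc_inj_of_le {a b c d : ℝ} (h : a ≤ b) (h' : c ≤ d) :
    Icc a b = Icc c d ↔ a = c ∧ b = d := by
  refine ⟨fun he => ⟨?_, ?_⟩, fun he => by rw [he.1, he.2]⟩
  · rw [← csInf_Icc h, he, csInf_Icc h']
  · rw [← csSup_Icc h, he, csSup_Icc h']

theorem emb_ext_iff {e e' : EndPts} :
    e = e' ↔ ∀ r : Icc (0 : ℝ) 1, e.1 r = e'.1 r ∧ e.2 r = e'.2 r :=
  ⟨fun h r => by simp [h], fun h => Prod.ext (ContinuousMap.ext fun r => (h r).1)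
    (ContinuousMap.ext fun r => (h r).2)⟩

/-- Nonempty compact intervals add, and are compared, end point by end point. Hukuhara differences
thereby become vector subtraction, with cancellation for free. -/
theorem isSum_iff {p q w : FuzzyHat} : IsSum p q w ↔ emb p = emb q + emb w := by
  rw [emb_ext_iff, IsSum, Subtype.forall]
  refine forall₂_congr fun r hr => ?_
  rw [level_eq p hr, level_eq q hr, level_eq w hr,
    Icc_add_Icc_eq (q.lower_le_upper hr) (w.lower_le_upper hr), Icc_inj_of_le
    (p.lower_le_upper hr) (add_le_add (q.lower_le_upper hr) (w.lower_le_upper hr))]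
  rfl

theorem sumsEq_iff {p p' q q' : FuzzyHat} :
    SumsEq p p' q q' ↔ emb p + emb p' = emb q + emb q' := by
  rw [emb_ext_iff, SumsEq, Subtype.forall]
  refine forall₂_congr fun r hr => ?_
  rw [level_eq p hr, level_eq q hr, level_eq p' hr, level_eq q' hr,
    Icc_add_Icc_eq (q.lower_le_upper hr) (q'.lower_le_upper hr),
    Icc_add_Icc_eq (p.lower_le_upper hr) (p'.lower_le_upper hr), Icc_inj_of_le
    (add_le_add (p.lower_le_upper hr) (p'.lower_le_upper hr))
    (add_le_add (q.lower_le_upper hr) (q'.lower_le_upper hr))]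
  rfl

theorem level_sums_iff {p p' q q' q'' : FuzzyHat} :
    (∀ r ∈ Icc (0 : ℝ) 1, p.level r + p'.level r = q.level r + q'.level r + q''.level r) ↔
      emb p + emb p' = emb q + emb q' + emb q'' := by
  rw [emb_ext_iff, Subtype.forall]
  refine forall₂_congr fun r hr => ?_
  have h1 := p.lower_le_upper hr
  have h2 := p'.lower_le_upper hr
  have h3 := q.lower_le_upper hr
  have h4 := q'.lower_le_upper hr
  have h5 := q''.lower_le_upper hr
  rw [level_eq p hr, level_eq q hr, level_eq p' hr, level_eq q' hr, level_eq q'' hr,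
    Icc_add_Icc_eq h1 h2, Icc_add_Icc_eq h3 h4, Icc_add_Icc_eq (add_le_add h3 h4) h5,
    Icc_inj_of_le (add_le_add h1 h2) (add_le_add (add_le_add h3 h4) h5)]
  rfl

theorem isSMul_iff {p q : FuzzyHat} {c : ℝ} (hc : 0 < c) :
    IsSMul p c q ↔ emb p = c • emb q := by
  rw [emb_ext_iff, IsSMul, Subtype.forall]
  refine forall₂_congr fun r hr => ?_
  rw [level_eq p hr, level_eq q hr, LinearOrderedField.smul_Icc hc, Icc_inj_of_le
    (p.lower_le_upper hr) (mul_le_mul_of_nonneg_left (q.lower_le_upper hr) hc.le)]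
  rfl

theorem isKatInt_iff {α₁ α₂ ρ₁ ρ₂ : ℝ} {u : ℝ → ℝ → FuzzyHat} {x y : ℝ} {J : FuzzyHat} :
    IsKatInt α₁ α₂ ρ₁ ρ₂ u x y J ↔ ∀ r : Icc (0 : ℝ) 1,
      lowerL r (emb J) = katInt α₁ α₂ ρ₁ ρ₂ (fun s t => lowerL r (emb (u s t))) x y ∧
      upperL r (emb J) = katInt α₁ α₂ ρ₁ ρ₂ (fun s t => upperL r (emb (u s t))) x y := by
  rw [Subtype.forall]
  rfl

theorem exists_neg (z : FuzzyHat) : ∃ d : FuzzyHat, ∀ r ∈ Icc (0 : ℝ) 1,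
    d.lower r = -z.upper r ∧ d.upper r = -z.lower r := by
  have h := isFuzzy_emb z
  have : IsFuzzy (-(emb z).2, -(emb z).1) :=
    ⟨fun _ _ hr => neg_le_neg (h.2.1 hr), fun _ _ hr => neg_le_neg (h.1 hr), neg_le_neg h.2.2⟩
  obtain ⟨d, hd⟩ := this.exists_emb
  rw [emb_ext_iff] at hd
  exact ⟨d, fun r hr => hd ⟨r, hr⟩⟩

theorem smul_Icc_of_neg {a b c : ℝ} (hc : c < 0) : c • Icc a b = Icc (c * b) (c * a) := by
  ext x
  rw [Set.mem_smul_set_iff_inv_smul_mem₀ hc.ne, smul_eq_mul, inv_mul_eq_div, mem_Icc, mem_Icc,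
    le_div_iff_of_neg hc, div_le_iff_of_neg hc, mul_comm b, mul_comm a, and_comm]

/-- Increments in the cone make the forward gH-differences plain vector differences. For `t < x` the
gH-difference is the reflection of `u x ⊖ u t`, and the negative factor `(t - x)⁻¹` reflects it
back, so on both sides the gH-quotient is the ordinary slope of `emb ∘ u`. -/
theorem hasGHDerivOfType_i {u : ℝ → FuzzyHat} {v : FuzzyHat} {S : Set ℝ} {x : ℝ}
    (hx : x ∈ S) (hd : HasDerivWithinAt (fun t => emb (u t)) (emb v) S x)
    (hu : ∀ s ∈ S, ∀ t ∈ S, s ≤ t → IsFuzzy (emb (u t) - emb (u s))) :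
    HasGHDerivOfType GHType.i u v S x := by
  have hslope : ∀ t ∈ S \ {x}, IsFuzzy ((t - x)⁻¹ • (emb (u t) - emb (u x))) := by
    intro t ht
    rcases lt_or_gt_of_ne (show t ≠ x from ht.2) with h | h
    · rw [← neg_sub (emb (u x)), smul_neg, ← neg_smul]
      exact (hu t ht.1 x hx h.le).smul (neg_nonneg.2 (inv_nonpos.2 (sub_neg.2 h).le))
    · exact (hu x hx t ht.1 h.le).smul (inv_nonneg.2 (sub_pos.2 h).le)
  refine ⟨⟨fun t => ofEndPts ((t - x)⁻¹ • (emb (u t) - emb (u x))), ?_, ?_⟩, fun r hr => ⟨?_, ?_⟩⟩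
  · filter_upwards [self_mem_nhdsWithin] with t ht
    have hs := hslope t ht
    rcases lt_or_gt_of_ne (show t ≠ x from ht.2) with h | h
    · obtain ⟨z, hz⟩ := (hu t ht.1 x hx h.le).exists_emb
      obtain ⟨d, hd⟩ := exists_neg z
      have hinv : (t - x)⁻¹ < 0 := inv_lt_zero.2 (sub_neg.2 h)
      have hq : emb (ofEndPts ((t - x)⁻¹ • (emb (u t) - emb (u x)))) = (-(t - x)⁻¹) • emb z := by
        rw [emb_ofEndPts hs, hz, neg_smul, ← smul_neg, neg_sub]
      have hsum : IsSum (u x) (u t) z := isSum_iff.2 (by rw [hz]; abel)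
      refine ⟨d, Or.inr fun r hr => ?_, fun r hr => ?_⟩
      · rw [hsum r hr, level_eq d hr, level_eq z hr, smul_Icc_of_neg (by norm_num),
          (hd r hr).1, (hd r hr).2]
        simp
      · have h1 := emb_ext_iff.1 hq ⟨r, hr⟩
        rw [level_eq _ hr, level_eq d hr, smul_Icc_of_neg hinv, (hd r hr).1, (hd r hr).2,
          mul_neg, mul_neg, ← neg_mul, ← neg_mul]
        exact congrArg₂ Icc h1.1 h1.2
    · have hf := hu x hx t ht.1 h.le
      have hc : 0 < (t - x)⁻¹ := inv_pos.2 (sub_pos.2 h)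
      refine ⟨ofEndPts (emb (u t) - emb (u x)), Or.inl (isSum_iff.2 ?_), (isSMul_iff hc).2 ?_⟩
      · rw [emb_ofEndPts hf]; abel
      · rw [emb_ofEndPts hf, emb_ofEndPts hs]
  · rw [isometry_emb.isUniformInducing.isInducing.tendsto_nhds_iff]
    rw [hasDerivWithinAt_iff_tendsto_slope] at hd
    refine hd.congr' ?_
    filter_upwards [self_mem_nhdsWithin] with t ht
    exact (emb_ofEndPts (hslope t ht)).symm
  · exact (lowerL ⟨r, hr⟩).hasFDerivAt.comp_hasDerivWithinAt x hd
  · exact (upperL ⟨r, hr⟩).hasFDerivAt.comp_hasDerivWithinAt x hd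

end FuzzyHat

/-! ### Bounded continuous functions on half-open domains -/

/-- `f` is continuous and bounded on `S`. -/
def ContBdd {P E : Type*} [TopologicalSpace P] [NormedAddCommGroup E] (f : P → E) (S : Set P) :
    Prop :=
  ContinuousOn f S ∧ ∃ C, ∀ p ∈ S, ‖f p‖ ≤ C

namespace ContBdd

variable {P Q E F : Type*} [TopologicalSpace P] [TopologicalSpace Q] [NormedAddCommGroup E]
  [NormedAddCommGroup F] {f g : P → E} {S : Set P}

theorem mono (h : ContBdd f S) {T : Set P} (hT : T ⊆ S) : ContBdd f T :=
  ⟨h.1.mono hT, h.2.imp fun _ hC _ hp => hC _ (hT hp)⟩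

theorem comp (h : ContBdd f S) {u : Q → P} {T : Set Q} (hu : ContinuousOn u T)
    (hm : MapsTo u T S) : ContBdd (fun q => f (u q)) T :=
  ⟨h.1.comp hu hm, h.2.imp fun _ hC _ hp => hC _ (hm hp)⟩

theorem congr (h : ContBdd f S) (hfg : EqOn g f S) : ContBdd g S :=
  ⟨h.1.congr hfg, h.2.imp fun _ hC p hp => by rw [hfg hp]; exact hC p hp⟩

theorem clm [NormedSpace ℝ E] [NormedSpace ℝ F] (h : ContBdd f S) (L : E →L[ℝ] F) :
    ContBdd (fun p => L (f p)) S := by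
  obtain ⟨h1, C, hC⟩ := h
  refine ⟨L.continuous.comp_continuousOn h1, ‖L‖ * C, fun p hp => (L.le_opNorm _).trans ?_⟩
  exact mul_le_mul_of_nonneg_left (hC p hp) (norm_nonneg _)

theorem of_isCompact (h : ContinuousOn f S) (hS : IsCompact S) : ContBdd f S :=
  ⟨h, hS.exists_bound_of_continuousOn h⟩

theorem slice_right {f : P × Q → E} {S : Set P} {T : Set Q} (h : ContBdd f (S ×ˢ T)) {p : P}
    (hp : p ∈ S) : ContBdd (fun q => f (p, q)) T :=
  h.comp (Continuous.prodMk_right p).continuousOn fun _ hq => ⟨hp, hq⟩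

theorem slice_left {f : P × Q → E} {S : Set P} {T : Set Q} (h : ContBdd f (S ×ˢ T)) {q : Q}
    (hq : q ∈ T) : ContBdd (fun p => f (p, q)) S :=
  h.comp (Continuous.prodMk_left q).continuousOn fun _ hp => ⟨hp, hq⟩

theorem swap {f : P × Q → E} {S : Set P} {T : Set Q} (h : ContBdd f (S ×ˢ T)) :
    ContBdd (fun q : Q × P => f (q.2, q.1)) (T ×ˢ S) :=
  h.comp (u := fun q : Q × P => (q.2, q.1)) (by fun_prop) fun _ hq => ⟨hq.2, hq.1⟩

end ContBdd

/-! ### Katugampola integrals in one variable -/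

/-- The kernel of the Katugampola integral. -/
noncomputable def katKer (α ρ x s : ℝ) : ℝ := s ^ (ρ - 1) / (x ^ ρ - s ^ ρ) ^ (1 - α)

/-- The Katugampola integral of a vector-valued function. -/
noncomputable def katIntE {E : Type*} [NormedAddCommGroup E] [NormedSpace ℝ E] (α ρ : ℝ)
    (f : ℝ → E) (x : ℝ) : E :=
  if α = 0 then f x else (ρ ^ (1 - α) / Real.Gamma α) • ∫ s in (0 : ℝ)..x, katKer α ρ x s • f s

theorem katKer_nonneg {α ρ x s : ℝ} (hρ : 0 < ρ) (hs : s ∈ Icc 0 x) : 0 ≤ katKer α ρ x s :=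
  div_nonneg (Real.rpow_nonneg hs.1 _)
    (Real.rpow_nonneg (sub_nonneg.2 (Real.rpow_le_rpow hs.1 hs.2 hρ.le)) _)

theorem katKer_eq {α ρ x s : ℝ} (hρ : 0 < ρ) (hs : s ∈ Icc 0 x) :
    katKer α ρ x s = s ^ (ρ - 1) * (x ^ ρ - s ^ ρ) ^ (α - 1) := by
  rw [katKer, div_eq_mul_inv, ← Real.rpow_neg
    (sub_nonneg.2 (Real.rpow_le_rpow hs.1 hs.2 hρ.le)), neg_sub]

theorem measurable_katKer (α ρ x : ℝ) : Measurable (katKer α ρ x) := by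
  unfold katKer
  fun_prop

/-- The primitive is continuous up to `s = x` even where the kernel blows up. Since the kernel is
nonnegative, its integrability and its integral can both be read off from this primitive. -/
theorem katKer_antideriv {α ρ x : ℝ} (hα : 0 < α) (hρ : 0 < ρ) {s : ℝ} (hs : s ∈ Ioo 0 x) :
    HasDerivAt (fun s => -((x ^ ρ - s ^ ρ) ^ α / (ρ * α))) (katKer α ρ x s) s := by
  have hpos : 0 < x ^ ρ - s ^ ρ := sub_pos.2 (Real.rpow_lt_rpow hs.1.le hs.2 hρ)
  have h1 : HasDerivAt (fun s : ℝ => x ^ ρ - s ^ ρ) (-(ρ * s ^ (ρ - 1))) s := by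
    simpa using (Real.hasDerivAt_rpow_const (p := ρ) (Or.inl hs.1.ne')).const_sub (x ^ ρ)
  have h2 := ((h1.rpow_const (p := α) (Or.inl hpos.ne')).div_const (ρ * α)).neg
  refine h2.congr_deriv ?_
  rw [katKer_eq hρ ⟨hs.1.le, hs.2.le⟩]
  field_simp

theorem katKer_antideriv_continuous {α ρ x : ℝ} (hα : 0 < α) (hρ : 0 < ρ) :
    Continuous (fun s : ℝ => -((x ^ ρ - s ^ ρ) ^ α / (ρ * α))) := by
  refine ((Continuous.rpow_const ?_ fun _ => Or.inr hα.le).div_const _).neg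
  exact continuous_const.sub (Real.continuous_rpow_const hρ.le)

theorem integrableOn_katKer {α ρ x : ℝ} (hα : 0 < α) (hρ : 0 < ρ) :
    IntegrableOn (katKer α ρ x) (Ioc 0 x) :=
  intervalIntegral.integrableOn_deriv_of_nonneg (katKer_antideriv_continuous hα hρ).continuousOn
    (fun _ hs => katKer_antideriv hα hρ hs) fun _ hs => katKer_nonneg hρ ⟨hs.1.le, hs.2.le⟩

theorem integral_katKer {α ρ x : ℝ} (hα : 0 < α) (hρ : 0 < ρ) (hx : 0 ≤ x) :
    ∫ s in (0 : ℝ)..x, katKer α ρ x s = (x ^ ρ) ^ α / (ρ * α) := by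
  rw [intervalIntegral.integral_eq_sub_of_hasDerivAt_of_le hx
    (katKer_antideriv_continuous hα hρ).continuousOn (fun _ hs => katKer_antideriv hα hρ hs)
    ((intervalIntegrable_iff_integrableOn_Ioc_of_le hx).2 (integrableOn_katKer hα hρ))]
  simp [Real.zero_rpow hρ.ne', Real.zero_rpow hα.ne']

section KatIntE

variable {E F : Type*} [NormedAddCommGroup E] [NormedSpace ℝ E] [NormedAddCommGroup F]
  [NormedSpace ℝ F] {α ρ a x : ℝ} {f g : ℝ → E}

theorem ContBdd.integrableOn_katKer_smul (hf : ContBdd f (Ioc 0 a)) (hα : 0 < α) (hρ : 0 < ρ)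
    (hx : x ≤ a) : IntegrableOn (fun s => katKer α ρ x s • f s) (Ioc 0 x) := by
  obtain ⟨C, hC⟩ := hf.2
  refine Integrable.mono' ((integrableOn_katKer hα hρ (x := x)).norm.mul_const C)
    ((measurable_katKer α ρ x).aestronglyMeasurable.smul
      ((hf.1.mono (Ioc_subset_Ioc_right hx)).aestronglyMeasurable measurableSet_Ioc)) ?_
  filter_upwards [ae_restrict_mem measurableSet_Ioc] with s hs
  rw [norm_smul]
  exact mul_le_mul_of_nonneg_left (hC s ⟨hs.1, hs.2.trans hx⟩) (norm_nonneg _)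

theorem ContBdd.intervalIntegrable_katKer_smul (hf : ContBdd f (Ioc 0 a)) (hα : 0 < α)
    (hρ : 0 < ρ) (hx : x ∈ Icc 0 a) :
    IntervalIntegrable (fun s => katKer α ρ x s • f s) volume 0 x :=
  (intervalIntegrable_iff_integrableOn_Ioc_of_le hx.1).2
    (hf.integrableOn_katKer_smul hα hρ hx.2)

theorem katIntE_of_pos (hα : 0 < α) : katIntE α ρ f x =
    (ρ ^ (1 - α) / Real.Gamma α) • ∫ s in (0 : ℝ)..x, katKer α ρ x s • f s :=
  if_neg hα.ne'

theorem katIntE_zero_order : katIntE 0 ρ f x = f x := if_pos rfl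

theorem katIntE_at_zero (hα : 0 < α) : katIntE α ρ f 0 = 0 := by
  simp [katIntE_of_pos hα]

theorem katIntE_congr (hα : 0 < α) (hx : 0 ≤ x) (h : EqOn f g (Ioc 0 x)) :
    katIntE α ρ f x = katIntE α ρ g x := by
  rw [katIntE_of_pos hα, katIntE_of_pos hα, intervalIntegral.integral_congr_ae]
  refine Eventually.of_forall fun s hs => ?_
  rw [uIoc_of_le hx] at hs
  simp only [h hs]

theorem katIntE_congr_Icc (hα : 0 ≤ α) (hx : 0 ≤ x) (h : EqOn f g (Icc 0 x)) :
    katIntE α ρ f x = katIntE α ρ g x := by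
  rcases hα.eq_or_lt with rfl | hα
  · simp only [katIntE_zero_order]
    exact h ⟨hx, le_rfl⟩
  · exact katIntE_congr hα hx (h.mono Ioc_subset_Icc_self)

theorem ContBdd.clm_katIntE [CompleteSpace E] [CompleteSpace F] (hf : ContBdd f (Ioc 0 a))
    (L : E →L[ℝ] F) (hα : 0 < α) (hρ : 0 < ρ) (hx : x ∈ Icc 0 a) :
    L (katIntE α ρ f x) = katIntE α ρ (fun s => L (f s)) x := by
  rw [katIntE_of_pos hα, katIntE_of_pos hα, map_smul,
    ← L.intervalIntegral_comp_comm (hf.intervalIntegrable_katKer_smul hα hρ hx)]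
  simp only [map_smul]

theorem ContBdd.katIntE_sub (hf : ContBdd f (Ioc 0 a)) (hg : ContBdd g (Ioc 0 a))
    (hα : 0 < α) (hρ : 0 < ρ) (hx : x ∈ Icc 0 a) :
    katIntE α ρ f x - katIntE α ρ g x = katIntE α ρ (fun s => f s - g s) x := by
  simp only [katIntE_of_pos hα, smul_sub]
  rw [intervalIntegral.integral_sub (hf.intervalIntegrable_katKer_smul hα hρ hx)
    (hg.intervalIntegrable_katKer_smul hα hρ hx), smul_sub]

theorem katIntE_const_eq (hα : 0 < α) (hρ : 0 < ρ) (hx : 0 ≤ x) :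
    ρ ^ (1 - α) / Real.Gamma α * ((x ^ ρ) ^ α / (ρ * α)) =
      (x ^ ρ / ρ) ^ α / Real.Gamma (α + 1) := by
  rw [Real.Gamma_add_one hα.ne', Real.div_rpow (Real.rpow_nonneg hx _) hρ.le, Real.rpow_sub hρ,
    Real.rpow_one]
  have := (Real.Gamma_pos_of_pos hα).ne'
  have := (Real.rpow_pos_of_pos hρ α).ne'
  field_simp

/-- The factor is the integral of the normalized kernel; taken at `x = a` and `x = b`, such factors
make up `Ξ / R`. -/
theorem norm_katIntE_le (hα : 0 < α) (hρ : 0 < ρ) (hx : 0 ≤ x) {C : ℝ}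
    (hC : ∀ s ∈ Ioc 0 x, ‖f s‖ ≤ C) :
    ‖katIntE α ρ f x‖ ≤ (x ^ ρ / ρ) ^ α / Real.Gamma (α + 1) * C := by
  have hc : 0 ≤ ρ ^ (1 - α) / Real.Gamma α :=
    div_nonneg (Real.rpow_nonneg hρ.le _) (Real.Gamma_pos_of_pos hα).le
  rw [katIntE_of_pos hα, norm_smul, Real.norm_of_nonneg hc, ← katIntE_const_eq hα hρ hx,
    mul_assoc]
  refine mul_le_mul_of_nonneg_left ?_ hc
  rw [← integral_katKer hα hρ hx, ← intervalIntegral.integral_mul_const]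
  refine intervalIntegral.norm_integral_le_of_norm_le hx ?_
    (((intervalIntegrable_iff_integrableOn_Ioc_of_le hx).2
      (integrableOn_katKer hα hρ)).mul_const C)
  refine Eventually.of_forall fun s hs => ?_
  rw [norm_smul, Real.norm_of_nonneg (katKer_nonneg hρ ⟨hs.1.le, hs.2⟩)]
  exact mul_le_mul_of_nonneg_left (hC s hs) (katKer_nonneg hρ ⟨hs.1.le, hs.2⟩)

theorem katKer_scale (hρ : 0 < ρ) (hx : 0 < x) {t : ℝ} (ht : t ∈ Icc (0 : ℝ) 1) :
    x * katKer α ρ x (x * t) = (x ^ ρ) ^ α * katKer α ρ 1 t := by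
  have h1 : 0 ≤ 1 - t ^ ρ := sub_nonneg.2 (Real.rpow_le_one ht.1 ht.2 hρ.le)
  have hxp : 0 < x ^ ρ := Real.rpow_pos_of_pos hx _
  rw [katKer, katKer, Real.mul_rpow hx.le ht.1, Real.mul_rpow hx.le ht.1, Real.one_rpow,
    show x ^ ρ - x ^ ρ * t ^ ρ = x ^ ρ * (1 - t ^ ρ) by ring, Real.mul_rpow hxp.le h1,
    Real.rpow_sub hx, Real.rpow_one, Real.rpow_sub hxp, Real.rpow_one]
  have := (Real.rpow_pos_of_pos hxp α).ne'
  have := hxp.ne'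
  -- At `t = 1` the denominator can vanish; both sides are then `0` by the convention on division.
  by_cases h0 : (1 - t ^ ρ) ^ (1 - α) = 0
  · simp [h0]
  · field_simp

/-- The substitution `s = x t` fixes the interval and the singularity of the kernel, so that `x`
enters only through a power and the argument of `f`. -/
theorem katIntE_scale (hα : 0 < α) (hρ : 0 < ρ) (hx : 0 < x) : katIntE α ρ f x =
    (ρ ^ (1 - α) / Real.Gamma α * (x ^ ρ) ^ α) •
      ∫ t in (0 : ℝ)..1, katKer α ρ 1 t • f (x * t) := by
  rw [katIntE_of_pos hα, mul_smul]
  congr 1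
  have h := intervalIntegral.integral_comp_mul_left (a := 0) (b := 1)
    (fun s => katKer α ρ x s • f s) hx.ne'
  rw [mul_zero, mul_one, eq_inv_smul_iff₀ hx.ne', ← intervalIntegral.integral_smul] at h
  rw [← h, ← intervalIntegral.integral_smul]
  refine intervalIntegral.integral_congr fun t ht => ?_
  rw [uIcc_of_le zero_le_one] at ht
  simp only [smul_smul]
  rw [katKer_scale hρ hx ht]

/-- At `x = 0` continuity comes from the bound by a multiple of `(x ^ ρ / ρ) ^ α`; for `x > 0` it
comes from the rescaled integral and dominated convergence. The integral is thus continuous up to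
`0` although `f` is controlled only on `(0, a]`. The parameter plays the role of the other variable
in the mixed integral. -/
theorem ContBdd.katIntE_param {P : Type*} [TopologicalSpace P] [FirstCountableTopology P]
    {f : P → ℝ → E} {S : Set P} (hf : ContBdd (fun q : P × ℝ => f q.1 q.2) (S ×ˢ Ioc 0 a))
    (hα : 0 < α) (hρ : 0 < ρ) :
    ContBdd (fun q : P × ℝ => katIntE α ρ (f q.1) q.2) (S ×ˢ Icc 0 a) := by
  obtain ⟨hfc, C, hC⟩ := hf
  have hΓ : 0 < Real.Gamma (α + 1) := Real.Gamma_pos_of_pos (by linarith)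
  have hbd : ∀ q ∈ S ×ˢ Icc 0 a,
      ‖katIntE α ρ (f q.1) q.2‖ ≤ (q.2 ^ ρ / ρ) ^ α / Real.Gamma (α + 1) * C :=
    fun q hq => norm_katIntE_le hα hρ hq.2.1 fun s hs =>
      hC (q.1, s) ⟨hq.1, hs.1, hs.2.trans hq.2.2⟩
  have hcont : Continuous fun x : ℝ => (x ^ ρ / ρ) ^ α / Real.Gamma (α + 1) * C := by
    refine Continuous.mul (Continuous.div_const (Continuous.rpow_const ?_ fun _ =>
      Or.inr hα.le) _) continuous_const
    exact (Real.continuous_rpow_const hρ.le).div_const _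
  refine ⟨?_, ?_⟩
  · rintro ⟨p, x⟩ ⟨hp, hx⟩
    rcases hx.1.eq_or_lt with h | h
    · simp only at h
      subst h
      have h0 : katIntE α ρ (f p) 0 = 0 := katIntE_at_zero hα
      rw [ContinuousWithinAt, h0]
      refine squeeze_zero_norm' (eventually_nhdsWithin_of_forall hbd) ?_
      have : Tendsto (fun q : P × ℝ => (q.2 ^ ρ / ρ) ^ α / Real.Gamma (α + 1) * C)
          (𝓝 (p, 0)) (𝓝 (((0 : ℝ) ^ ρ / ρ) ^ α / Real.Gamma (α + 1) * C)) :=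
        (hcont.comp continuous_snd).tendsto _
      rw [Real.zero_rpow hρ.ne', zero_div, Real.zero_rpow hα.ne', zero_div, zero_mul] at this
      exact this.mono_left nhdsWithin_le_nhds
    · simp only at h
      have hmem : S ×ˢ Ioc 0 a ∈ 𝓝[S ×ˢ Icc 0 a] (p, x) := by
        have : (univ : Set P) ×ˢ Ioi (0 : ℝ) ∈ 𝓝 (p, x) :=
          prod_mem_nhds univ_mem (Ioi_mem_nhds h)
        filter_upwards [self_mem_nhdsWithin, nhdsWithin_le_nhds this] with q hq hq'
        exact ⟨hq.1, hq'.2, hq.2.2⟩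
      refine ContinuousWithinAt.mono_of_mem_nhdsWithin ?_ hmem
      refine ContinuousWithinAt.congr (f := fun q : P × ℝ =>
        (ρ ^ (1 - α) / Real.Gamma α * (q.2 ^ ρ) ^ α) •
          ∫ t in (0 : ℝ)..1, katKer α ρ 1 t • f q.1 (q.2 * t)) ?_
        (fun q hq => katIntE_scale hα hρ hq.2.1) (katIntE_scale hα hρ h)
      refine ContinuousWithinAt.smul ?_ ?_
      · refine (continuousWithinAt_const.mul (Continuous.continuousWithinAt ?_))
        exact (((Real.continuous_rpow_const hρ.le).comp continuous_snd).rpow_const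
          fun _ => Or.inr hα.le)
      · have hmaps : ∀ q ∈ S ×ˢ Ioc 0 a, ∀ t ∈ Ioc (0 : ℝ) 1, (q.1, q.2 * t) ∈ S ×ˢ Ioc 0 a :=
          fun q hq t ht => ⟨hq.1, mul_pos hq.2.1 ht.1,
            (mul_le_of_le_one_right hq.2.1.le ht.2).trans hq.2.2⟩
        refine intervalIntegral.continuousWithinAt_of_dominated_interval
          (bound := fun t => ‖katKer α ρ 1 t‖ * C) ?_ ?_ ?_ ?_
        · filter_upwards [self_mem_nhdsWithin] with q hq
          rw [uIoc_of_le zero_le_one]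
          refine (measurable_katKer α ρ 1).aestronglyMeasurable.smul
            (ContinuousOn.aestronglyMeasurable ?_ measurableSet_Ioc)
          exact hfc.comp (f := fun t => (q.1, q.2 * t)) (by fun_prop)
            fun t ht => hmaps q hq t ht
        · filter_upwards [self_mem_nhdsWithin] with q hq
          refine Eventually.of_forall fun t ht => ?_
          rw [uIoc_of_le zero_le_one] at ht
          rw [norm_smul]
          exact mul_le_mul_of_nonneg_left (hC _ (hmaps q hq t ht)) (norm_nonneg _)
        · exact ((intervalIntegrable_iff_integrableOn_Ioc_of_le zero_le_one).2
            (integrableOn_katKer hα hρ)).norm.mul_const C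
        · refine Eventually.of_forall fun t ht => ?_
          rw [uIoc_of_le zero_le_one] at ht
          refine continuousWithinAt_const.smul ?_
          have := hfc.comp (f := fun q : P × ℝ => (q.1, q.2 * t)) (s := S ×ˢ Ioc 0 a)
            (by fun_prop) fun q hq => hmaps q hq t ht
          exact this (p, x) ⟨hp, h, hx.2⟩
  · obtain ⟨B, hB⟩ := (isCompact_Icc (a := (0 : ℝ)) (b := a)).exists_bound_of_continuousOn
      hcont.continuousOn
    exact ⟨B, fun q hq => (hbd q hq).trans ((le_abs_self _).trans (hB q.2 hq.2))⟩

theorem katIntE_one : katIntE 1 ρ f x = ∫ s in (0 : ℝ)..x, s ^ (ρ - 1) • f s := by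
  simp [katIntE_of_pos one_pos, katKer]

theorem ContBdd.intervalIntegrable_rpow_smul (hf : ContBdd f (Ioc 0 a))
    (hρ : 0 < ρ) (hx : x ∈ Icc 0 a) :
    IntervalIntegrable (fun s => s ^ (ρ - 1) • f s) volume 0 x := by
  simpa [katKer] using hf.intervalIntegrable_katKer_smul one_pos hρ hx

theorem ContBdd.hasDerivWithinAt_katIntE_one [CompleteSpace E] (hf : ContBdd f (Ioc 0 a))
    (hρ : 0 < ρ) (hx : x ∈ Ioc 0 a) :
    HasDerivWithinAt (katIntE 1 ρ f) (x ^ (ρ - 1) • f x) (Ioc 0 a) x := by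
  have heq : katIntE 1 ρ f = fun x => ∫ s in (0 : ℝ)..x, s ^ (ρ - 1) • f s :=
    funext fun x => katIntE_one
  rw [heq]
  -- The weight `s ^ (ρ - 1)` may be singular at `0`. On `[x/2, a]` the integrand is continuous, and
  -- near `x` this interval contains all points of `(0, a]`.
  have hx2 : x / 2 < x := half_lt_self hx.1
  have : Fact (x ∈ Icc (x / 2) a) := ⟨hx2.le, hx.2⟩
  have hc : ContinuousOn (fun s : ℝ => s ^ (ρ - 1) • f s) (Ioc 0 a) :=
    ContinuousOn.smul (fun s hs => (Real.continuousAt_rpow_const _ _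
      (Or.inl hs.1.ne')).continuousWithinAt) hf.1
  have hsub : Icc (x / 2) a ⊆ Ioc 0 a := fun s hs => ⟨(half_pos hx.1).trans_le hs.1, hs.2⟩
  have h := intervalIntegral.integral_hasDerivWithinAt_right (s := Icc (x / 2) a)
    (t := Icc (x / 2) a) (hf.intervalIntegrable_rpow_smul hρ ⟨hx.1.le, hx.2⟩)
    ⟨Icc (x / 2) a, self_mem_nhdsWithin,
      (hc.mono hsub).aestronglyMeasurable measurableSet_Icc⟩
    ((hc.mono hsub) x ⟨hx2.le, hx.2⟩)
  refine h.mono_of_mem_nhdsWithin ?_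
  filter_upwards [self_mem_nhdsWithin, nhdsWithin_le_nhds (Ioi_mem_nhds hx2)] with s hs hs'
  exact ⟨le_of_lt hs', hs.2⟩

end KatIntE

theorem EndPts.IsFuzzy.isFuzzy_katIntE {f : ℝ → EndPts} {α ρ x : ℝ} (hα : 0 < α) (hρ : 0 < ρ)
    (hx : 0 ≤ x) (h : ∀ s ∈ Ioc 0 x, IsFuzzy (f s)) : IsFuzzy (katIntE α ρ f x) := by
  rw [katIntE_of_pos hα]
  refine IsFuzzy.smul (IsFuzzy.intervalIntegral hx fun s hs => (h s hs).smul
    (katKer_nonneg hρ ⟨hs.1.le, hs.2⟩)) ?_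
  exact div_nonneg (Real.rpow_nonneg hρ.le _) (Real.Gamma_pos_of_pos hα).le

/-- An increment of the order-one integral is an integral of cone values with a nonnegative weight.
This is the increment condition required by `hasGHDerivOfType_i`. -/
theorem EndPts.IsFuzzy.katIntE_one_sub {f : ℝ → EndPts} {ρ a x y : ℝ}
    (hf : ContBdd f (Ioc 0 a)) (hρ : 0 < ρ) (h : ∀ s ∈ Ioc 0 a, IsFuzzy (f s))
    (hx : 0 ≤ x) (hxy : x ≤ y) (hy : y ≤ a) :
    IsFuzzy (katIntE 1 ρ f y - katIntE 1 ρ f x) := by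
  rw [katIntE_one, katIntE_one, intervalIntegral.integral_interval_sub_left
    (hf.intervalIntegrable_rpow_smul hρ ⟨hx.trans hxy, hy⟩)
    (hf.intervalIntegrable_rpow_smul hρ ⟨hx, hxy.trans hy⟩)]
  exact IsFuzzy.intervalIntegral hxy fun s hs => (h s ⟨hx.trans_lt hs.1, hs.2.trans hy⟩).smul
    (Real.rpow_nonneg (hx.trans hs.1.le) _)

theorem ContBdd.katIntE_mono {f g : ℝ → ℝ} {α ρ a x : ℝ} (hf : ContBdd f (Ioc 0 a))
    (hg : ContBdd g (Ioc 0 a)) (hα : 0 < α) (hρ : 0 < ρ) (hx : x ∈ Icc 0 a)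
    (h : ∀ s ∈ Ioc 0 a, f s ≤ g s) : katIntE α ρ f x ≤ katIntE α ρ g x := by
  rw [katIntE_of_pos hα, katIntE_of_pos hα, intervalIntegral.integral_of_le hx.1,
    intervalIntegral.integral_of_le hx.1]
  refine mul_le_mul_of_nonneg_left (setIntegral_mono_on (hf.integrableOn_katKer_smul hα hρ hx.2)
    (hg.integrableOn_katKer_smul hα hρ hx.2) measurableSet_Ioc fun s hs => ?_)
    (div_nonneg (Real.rpow_nonneg hρ.le _) (Real.Gamma_pos_of_pos hα).le)
  exact mul_le_mul_of_nonneg_left (h s ⟨hs.1, hs.2.trans hx.2⟩)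
    (katKer_nonneg hρ ⟨hs.1.le, hs.2⟩)

/-! ### The beta integral, the semigroup law and injectivity -/

theorem integral_Ioo_beta {α β : ℝ} (hα : 0 < α) (hβ : 0 < β) :
    ∫ u in Ioo (0 : ℝ) 1, u ^ (α - 1) * (1 - u) ^ (β - 1) =
      Real.Gamma α * Real.Gamma β / Real.Gamma (α + β) := by
  have h := ProbabilityTheory.beta_eq_betaIntegralReal α β hα hβ
  rw [ProbabilityTheory.beta] at h
  rw [h, Complex.betaIntegral, ← integral_Ioc_eq_integral_Ioo,
    ← intervalIntegral.integral_of_le zero_le_one, ← Complex.ofReal_re (∫ u in (0 : ℝ)..1, _),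
    ← intervalIntegral.integral_ofReal]
  congr 1
  refine intervalIntegral.integral_congr fun u hu => ?_
  rw [uIcc_of_le zero_le_one] at hu
  rw [Complex.ofReal_mul, Complex.ofReal_cpow hu.1, Complex.ofReal_cpow (sub_nonneg.2 hu.2)]
  push_cast
  rfl

/-- The substitution `u = (s ^ ρ - t ^ ρ) / (x ^ ρ - t ^ ρ)` turns this into a beta integral.
Because `α + β = 1`, the powers of the denominator cancel and the value depends on neither `t` nor
`x`. -/
theorem integral_Ioo_katKer_mul {α β ρ t x : ℝ} (hα : 0 < α) (hβ : 0 < β) (hαβ : α + β = 1)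
    (hρ : 0 < ρ) (ht : 0 < t) (htx : t < x) :
    ∫ s in Ioo t x, s ^ (ρ - 1) * (x ^ ρ - s ^ ρ) ^ (α - 1) * (s ^ ρ - t ^ ρ) ^ (β - 1) =
      Real.Gamma α * Real.Gamma β / ρ := by
  have hx : 0 < x := ht.trans htx
  set Δ := x ^ ρ - t ^ ρ with hΔ
  have hΔ0 : 0 < Δ := sub_pos.2 (Real.rpow_lt_rpow ht.le htx hρ)
  have himg : (fun s : ℝ => (s ^ ρ - t ^ ρ) / Δ) '' Ioo t x = Ioo 0 1 := by
    ext v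
    constructor
    · rintro ⟨s, hs, rfl⟩
      have h1 := Real.rpow_lt_rpow ht.le hs.1 hρ
      have h2 := Real.rpow_lt_rpow (ht.trans hs.1).le hs.2 hρ
      exact ⟨div_pos (sub_pos.2 h1) hΔ0, (div_lt_one hΔ0).2 (by linarith)⟩
    · intro hv
      have hc : ContinuousOn (fun s : ℝ => (s ^ ρ - t ^ ρ) / Δ) (Icc t x) :=
        (((Real.continuous_rpow_const hρ.le).sub continuous_const).div_const _).continuousOn
      have := intermediate_value_Ioo htx.le hc
      simp only [sub_self, zero_div] at this
      rw [← hΔ, div_self hΔ0.ne'] at this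
      exact this hv
  have hder : ∀ s ∈ Ioo t x, HasDerivWithinAt (fun s : ℝ => (s ^ ρ - t ^ ρ) / Δ)
      (ρ * s ^ (ρ - 1) / Δ) (Ioo t x) s := fun s hs =>
    (((Real.hasDerivAt_rpow_const (p := ρ) (Or.inl (ht.trans hs.1).ne')).sub_const
      _).div_const _).hasDerivWithinAt
  have hinj : InjOn (fun s : ℝ => (s ^ ρ - t ^ ρ) / Δ) (Ioo t x) := by
    intro s hs s' hs' h
    simp only [div_left_inj' hΔ0.ne', sub_left_inj] at h
    exact Real.rpow_left_injOn hρ.ne' (ht.trans hs.1).le (ht.trans hs'.1).le h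
  have h := integral_image_eq_integral_abs_deriv_smul measurableSet_Ioo hder hinj
    (fun u => u ^ (β - 1) * (1 - u) ^ (α - 1))
  rw [himg, integral_Ioo_beta hβ hα, add_comm β α, hαβ, Real.Gamma_one, div_one] at h
  rw [eq_div_iff hρ.ne', mul_comm (Real.Gamma α), h, ← integral_mul_const]
  refine setIntegral_congr_fun measurableSet_Ioo fun s hs => ?_
  have hs0 := ht.trans hs.1
  have h1 : 0 < s ^ ρ - t ^ ρ := sub_pos.2 (Real.rpow_lt_rpow ht.le hs.1 hρ)
  have h2 : 0 < x ^ ρ - s ^ ρ := sub_pos.2 (Real.rpow_lt_rpow hs0.le hs.2 hρ)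
  have h3 : 1 - (s ^ ρ - t ^ ρ) / Δ = (x ^ ρ - s ^ ρ) / Δ := by
    field_simp
    rw [hΔ]; ring
  have h4 : Δ ^ (β - 1) * Δ ^ (α - 1) * Δ = 1 := by
    rw [← Real.rpow_add hΔ0, ← Real.rpow_add_one hΔ0.ne',
      show β - 1 + (α - 1) + 1 = 0 by linarith, Real.rpow_zero]
  have h5 : 0 ≤ ρ * s ^ (ρ - 1) / Δ :=
    div_nonneg (mul_nonneg hρ.le (Real.rpow_nonneg hs0.le _)) hΔ0.le
  simp only [smul_eq_mul]
  rw [abs_of_nonneg h5, h3, Real.div_rpow h1.le hΔ0.le, Real.div_rpow h2.le hΔ0.le]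
  have e1 := (Real.rpow_pos_of_pos hΔ0 (β - 1)).ne'
  have e2 := (Real.rpow_pos_of_pos hΔ0 (α - 1)).ne'
  field_simp
  linear_combination h4

section Semigroup

variable {α β ρ a x : ℝ} {f : ℝ → ℝ}

/-- The integrand of the iterated Katugampola integral on the triangle `t < s`. -/
noncomputable def katTri (α β ρ : ℝ) (f : ℝ → ℝ) (x s t : ℝ) : ℝ :=
  (Iio s).indicator (fun t => katKer α ρ x s * (katKer β ρ s t * f t)) t

theorem setIntegral_indicator_Iio {g : ℝ → ℝ} {s : ℝ} (hs : s ∈ Ioc 0 x) :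
    ∫ t in Ioc 0 x, (Iio s).indicator g t = ∫ t in (0 : ℝ)..s, g t := by
  rw [setIntegral_indicator measurableSet_Iio, intervalIntegral.integral_of_le hs.1.le,
    integral_Ioc_eq_integral_Ioo]
  congr 2
  ext t
  exact ⟨fun h => ⟨h.1.1, h.2⟩, fun h => ⟨⟨h.1, h.2.le.trans hs.2⟩, h.2⟩⟩

/-- This is the hypothesis of Fubini's theorem. Integrating the norm over `t` first leaves at most a
constant times the integrable outer kernel in `s`. -/
theorem ContBdd.integrable_katTri (hf : ContBdd f (Ioc 0 a)) (hα : 0 < α) (hβ : 0 < β)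
    (hρ : 0 < ρ) (hx : x ≤ a) : Integrable (Function.uncurry (katTri α β ρ f x))
      ((volume.restrict (Ioc 0 x)).prod (volume.restrict (Ioc 0 x))) := by
  obtain ⟨C, hC⟩ := hf.2
  have hfm : AEStronglyMeasurable f (volume.restrict (Ioc 0 x)) :=
    (hf.1.mono (Ioc_subset_Ioc_right hx)).aestronglyMeasurable measurableSet_Ioc
  have hm : AEStronglyMeasurable (Function.uncurry (katTri α β ρ f x))
      ((volume.restrict (Ioc 0 x)).prod (volume.restrict (Ioc 0 x))) := by
    have h1 : Measurable fun q : ℝ × ℝ => katKer α ρ x q.1 :=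
      (measurable_katKer α ρ x).comp measurable_fst
    have h2 : Measurable fun q : ℝ × ℝ => katKer β ρ q.1 q.2 := by
      unfold katKer; fun_prop
    have h3 : AEStronglyMeasurable (fun q : ℝ × ℝ =>
        katKer α ρ x q.1 * (katKer β ρ q.1 q.2 * f q.2))
        ((volume.restrict (Ioc 0 x)).prod (volume.restrict (Ioc 0 x))) :=
      h1.aestronglyMeasurable.mul (h2.aestronglyMeasurable.mul hfm.comp_snd)
    have h4 := h3.indicator (measurableSet_lt measurable_snd measurable_fst)
    refine h4.congr (Eventually.of_forall fun q => ?_)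
    simp [Function.uncurry, katTri, indicator]
  rw [integrable_prod_iff hm]
  refine ⟨?_, ?_⟩
  · filter_upwards [ae_restrict_mem measurableSet_Ioc] with s hs
    simp only [Function.uncurry, katTri]
    rw [integrable_indicator_iff measurableSet_Iio, IntegrableOn,
      Measure.restrict_restrict measurableSet_Iio]
    refine IntegrableOn.mono_set (t := Ioc 0 s)
      ((hf.integrableOn_katKer_smul hβ hρ (hs.2.trans hx)).const_mul _) ?_
    exact fun t ht => ⟨ht.2.1, le_of_lt ht.1⟩
  · refine Integrable.mono' (((integrableOn_katKer hα hρ (x := x)).mul_const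
      ((x ^ ρ) ^ β / (ρ * β) * |C|))) hm.norm.integral_prod_right' ?_
    filter_upwards [ae_restrict_mem measurableSet_Ioc] with s hs
    have hk := katKer_nonneg (α := α) hρ ⟨hs.1.le, hs.2⟩
    rw [Real.norm_of_nonneg (integral_nonneg fun _ => norm_nonneg _)]
    simp only [Function.uncurry, katTri, norm_indicator_eq_indicator_norm]
    rw [setIntegral_indicator_Iio hs]
    simp only [norm_mul, Real.norm_of_nonneg hk]
    rw [intervalIntegral.integral_const_mul]
    refine mul_le_mul_of_nonneg_left ?_ hk
    have hi := (intervalIntegrable_iff_integrableOn_Ioc_of_le hs.1.le).2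
      (integrableOn_katKer hβ hρ (x := s))
    have hi2 := (intervalIntegrable_iff_integrableOn_Ioc_of_le hs.1.le).2
      ((hf.integrableOn_katKer_smul hβ hρ (hs.2.trans hx)).norm)
    calc ∫ t in (0 : ℝ)..s, ‖katKer β ρ s t‖ * ‖f t‖
        ≤ ∫ t in (0 : ℝ)..s, katKer β ρ s t * |C| := by
          refine intervalIntegral.integral_mono_on_of_le_Ioo hs.1.le
            (by simpa only [norm_smul] using hi2) (hi.mul_const _) fun t ht => ?_
          have hk' := katKer_nonneg (α := β) hρ ⟨ht.1.le, ht.2.le⟩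
          rw [Real.norm_of_nonneg hk']
          exact mul_le_mul_of_nonneg_left ((hC t ⟨ht.1, (ht.2.le.trans hs.2).trans hx⟩).trans
            (le_abs_self _)) hk'
      _ = (s ^ ρ) ^ β / (ρ * β) * |C| := by
          rw [intervalIntegral.integral_mul_const, integral_katKer hβ hρ hs.1.le]
      _ ≤ (x ^ ρ) ^ β / (ρ * β) * |C| := by
          have := Real.rpow_le_rpow (Real.rpow_nonneg hs.1.le _)
            (Real.rpow_le_rpow hs.1.le hs.2 hρ.le) hβ.le
          gcongr

/-- The semigroup property of the Katugampola integrals, for orders with sum one. -/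
theorem ContBdd.katIntE_katIntE_of_pos (hf : ContBdd f (Ioc 0 a)) (hα : 0 < α) (hβ : 0 < β)
    (hαβ : α + β = 1) (hρ : 0 < ρ) (hx : x ∈ Icc 0 a) :
    katIntE α ρ (katIntE β ρ f) x = katIntE 1 ρ f x := by
  have hΓα := (Real.Gamma_pos_of_pos hα).ne'
  have hΓβ := (Real.Gamma_pos_of_pos hβ).ne'
  have h1 : ∀ s ∈ Ioc 0 x, katKer α ρ x s • katIntE β ρ f s =
      ρ ^ (1 - β) / Real.Gamma β * ∫ t in Ioc 0 x, katTri α β ρ f x s t := by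
    intro s hs
    rw [katIntE_of_pos hβ]
    simp only [katTri]
    rw [setIntegral_indicator_Iio hs, intervalIntegral.integral_const_mul]
    simp only [smul_eq_mul]
    ring
  -- With the order of integration exchanged, the `s`-integral over `(t, x)` is the beta-type
  -- integral, a constant.
  have h2 : ∀ t ∈ Ioo 0 x, ∫ s in Ioc 0 x, katTri α β ρ f x s t =
      Real.Gamma α * Real.Gamma β / ρ * (t ^ (ρ - 1) • f t) := by
    intro t ht
    have : ∀ s, katTri α β ρ f x s t =
        (Ioi t).indicator (fun s => katKer α ρ x s * (katKer β ρ s t * f t)) s := by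
      intro s
      simp [katTri, indicator]
    simp only [this]
    rw [setIntegral_indicator measurableSet_Ioi, ← integral_Ioo_katKer_mul hα hβ hαβ hρ ht.1 ht.2,
      ← integral_mul_const, show Ioc 0 x ∩ Ioi t = Ioc t x from ?_, integral_Ioc_eq_integral_Ioo]
    · refine setIntegral_congr_fun measurableSet_Ioo fun s hs => ?_
      simp only [smul_eq_mul]
      rw [katKer_eq hρ ⟨(ht.1.trans hs.1).le, hs.2.le⟩, katKer_eq hρ ⟨ht.1.le, hs.1.le⟩]
      ring
    · ext s
      exact ⟨fun h => ⟨h.2, h.1.2⟩, fun h => ⟨⟨ht.1.trans h.1, h.2⟩, h.1⟩⟩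
  rw [katIntE_of_pos hα, intervalIntegral.integral_of_le hx.1,
    setIntegral_congr_fun measurableSet_Ioc h1, integral_const_mul,
    integral_integral_swap (hf.integrable_katTri hα hβ hρ hx.2), katIntE_one,
    intervalIntegral.integral_of_le hx.1, integral_Ioc_eq_integral_Ioo,
    integral_Ioc_eq_integral_Ioo, setIntegral_congr_fun measurableSet_Ioo h2, integral_const_mul,
    smul_eq_mul]
  have hp : ρ ^ (1 - α) * ρ ^ (1 - β) = ρ := by
    rw [← Real.rpow_add hρ, show 1 - α + (1 - β) = 1 by linarith, Real.rpow_one]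
  field_simp
  rw [hp]

theorem ContBdd.katIntE_katIntE (hf : ContBdd f (Ioc 0 a)) (hβ : β ∈ Ioc (0 : ℝ) 1)
    (hρ : 0 < ρ) (hx : x ∈ Icc 0 a) :
    katIntE (1 - β) ρ (katIntE β ρ f) x = katIntE 1 ρ f x := by
  rcases hβ.2.eq_or_lt with rfl | h
  · rw [sub_self, katIntE_zero_order]
  · exact hf.katIntE_katIntE_of_pos (sub_pos.2 h) hβ.1 (sub_add_cancel _ _) hρ hx

/-- The Katugampola integral of order `1 - β` is injective on continuous functions. -/
theorem katIntE_injOn {g : ℝ → ℝ} (hf : ContBdd f (Ioc 0 a)) (hg : ContBdd g (Ioc 0 a))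
    (hβ : β ∈ Ioc (0 : ℝ) 1) (hρ : 0 < ρ)
    (h : ∀ x ∈ Icc 0 a, katIntE (1 - β) ρ f x = katIntE (1 - β) ρ g x) : EqOn f g (Ioc 0 a) := by
  intro x hx
  rcases hβ.2.eq_or_lt with rfl | hβ1
  · simpa only [sub_self, katIntE_zero_order] using h x ⟨hx.1.le, hx.2⟩
  -- Applying the integral of order `β` to both sides produces the order-one integrals;
  -- differentiating these recovers `f` and `g`.
  have h1 : EqOn (katIntE 1 ρ f) (katIntE 1 ρ g) (Icc 0 a) := by
    intro z hz
    rw [← hf.katIntE_katIntE_of_pos hβ.1 (sub_pos.2 hβ1) (by ring) hρ hz,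
      ← hg.katIntE_katIntE_of_pos hβ.1 (sub_pos.2 hβ1) (by ring) hρ hz]
    exact katIntE_congr hβ.1 hz.1 fun s hs => h s ⟨hs.1.le, hs.2.trans hz.2⟩
  have hd := (hg.hasDerivWithinAt_katIntE_one hρ hx).congr
    (fun z hz => h1 ⟨hz.1.le, hz.2⟩) (h1 ⟨hx.1.le, hx.2⟩)
  have hu : UniqueDiffWithinAt ℝ (Ioc 0 a) x := uniqueDiffOn_Ioc 0 a x hx
  have := hu.eq_deriv _ (hf.hasDerivWithinAt_katIntE_one hρ hx) hd
  exact mul_left_cancel₀ (Real.rpow_pos_of_pos hx.1 _).ne' this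

/-- Katugampola integrals in different variables commute. -/
theorem ContBdd.katIntE_comm {ρ' b y : ℝ} {H : ℝ → ℝ → ℝ}
    (hH : ContBdd (fun q : ℝ × ℝ => H q.1 q.2) (Ioc 0 a ×ˢ Ioc 0 b)) (hα : 0 < α) (hβ : 0 < β)
    (hρ : 0 < ρ) (hρ' : 0 < ρ') (hx : x ∈ Icc 0 a) (hy : y ∈ Icc 0 b) :
    katIntE β ρ' (fun t => katIntE α ρ (fun s => H s t) x) y =
      katIntE α ρ (fun s => katIntE β ρ' (H s) y) x := by
  simp only [katIntE_of_pos hα, katIntE_of_pos hβ, smul_eq_mul,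
    intervalIntegral.integral_of_le hx.1, intervalIntegral.integral_of_le hy.1,
    ← integral_const_mul]
  rw [integral_integral_swap]
  · refine setIntegral_congr_fun measurableSet_Ioc fun s hs => ?_
    refine setIntegral_congr_fun measurableSet_Ioc fun t ht => ?_
    ring
  · obtain ⟨C, hC⟩ := hH.2
    have hsub : Ioc 0 x ×ˢ Ioc 0 y ⊆ Ioc 0 a ×ˢ Ioc 0 b :=
      prod_mono (Ioc_subset_Ioc_right hx.2) (Ioc_subset_Ioc_right hy.2)
    have h1 := (integrableOn_katKer hβ hρ' (x := y)).mul_prod (integrableOn_katKer hα hρ (x := x))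
    have hm : AEStronglyMeasurable (fun q : ℝ × ℝ => H q.2 q.1)
        ((volume.restrict (Ioc 0 y)).prod (volume.restrict (Ioc 0 x))) := by
      rw [Measure.prod_restrict]
      exact (hH.swap.1.mono (prod_mono (Ioc_subset_Ioc_right hy.2)
        (Ioc_subset_Ioc_right hx.2))).aestronglyMeasurable
        (measurableSet_Ioc.prod measurableSet_Ioc)
    have hb : ∀ᵐ q : ℝ × ℝ ∂((volume.restrict (Ioc 0 y)).prod (volume.restrict (Ioc 0 x))),
        ‖H q.2 q.1‖ ≤ C := by
      rw [Measure.prod_restrict]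
      filter_upwards [ae_restrict_mem (measurableSet_Ioc.prod measurableSet_Ioc)] with q hq
      exact hC (q.2, q.1) (hsub ⟨hq.2, hq.1⟩)
    refine ((h1.mul_bdd hm hb).const_mul
      (ρ' ^ (1 - β) / Real.Gamma β * (ρ ^ (1 - α) / Real.Gamma α))).congr ?_
    refine Eventually.of_forall fun q => ?_
    simp only [Function.uncurry]
    ring

end Semigroup

/-! ### The mixed Katugampola integral: continuity, bounds and derivatives -/

/-- The mixed Katugampola integral of a vector-valued function. -/
noncomputable def katInt2 {E : Type*} [NormedAddCommGroup E] [NormedSpace ℝ E]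
    (α₁ α₂ ρ₁ ρ₂ : ℝ) (f : ℝ → ℝ → E) (x y : ℝ) : E :=
  katIntE α₁ ρ₁ (fun s => katIntE α₂ ρ₂ (f s) y) x

section KatInt2

variable {E F : Type*} [NormedAddCommGroup E] [NormedSpace ℝ E] [NormedAddCommGroup F]
  [NormedSpace ℝ F] {α₁ α₂ ρ₁ ρ₂ a b x y : ℝ} {f g : ℝ → ℝ → E}

theorem ContBdd.contBdd_katInt2 (hf : ContBdd (fun q : ℝ × ℝ => f q.1 q.2) (Ioc 0 a ×ˢ Ioc 0 b))
    (hα₁ : 0 < α₁) (hα₂ : 0 < α₂) (hρ₁ : 0 < ρ₁) (hρ₂ : 0 < ρ₂) :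
    ContBdd (fun q : ℝ × ℝ => katInt2 α₁ α₂ ρ₁ ρ₂ f q.1 q.2) (Icc 0 a ×ˢ Icc 0 b) :=
  (ContBdd.katIntE_param (f := fun y s => katIntE α₂ ρ₂ (f s) y)
    (hf.katIntE_param hα₂ hρ₂).swap hα₁ hρ₁).swap

theorem ContBdd.katIntE_param_of_nonneg
    (hf : ContBdd (fun q : ℝ × ℝ => f q.1 q.2) (Icc 0 a ×ˢ Icc 0 b))
    (hα₂ : 0 ≤ α₂) (hρ₂ : 0 < ρ₂) :
    ContBdd (fun q : ℝ × ℝ => katIntE α₂ ρ₂ (f q.1) q.2) (Icc 0 a ×ˢ Icc 0 b) := by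
  rcases hα₂.eq_or_lt with rfl | h
  · simpa only [katIntE_zero_order] using hf
  · exact (hf.mono (prod_mono_right Ioc_subset_Icc_self)).katIntE_param h hρ₂

theorem ContBdd.contBdd_katInt2_of_nonneg
    (hf : ContBdd (fun q : ℝ × ℝ => f q.1 q.2) (Icc 0 a ×ˢ Icc 0 b))
    (hα₁ : 0 ≤ α₁) (hα₂ : 0 ≤ α₂) (hρ₁ : 0 < ρ₁) (hρ₂ : 0 < ρ₂) :
    ContBdd (fun q : ℝ × ℝ => katInt2 α₁ α₂ ρ₁ ρ₂ f q.1 q.2) (Icc 0 a ×ˢ Icc 0 b) :=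
  (ContBdd.katIntE_param_of_nonneg (f := fun y s => katIntE α₂ ρ₂ (f s) y)
    (hf.katIntE_param_of_nonneg hα₂ hρ₂).swap hα₁ hρ₁).swap

theorem ContBdd.inner_katIntE (hf : ContBdd (fun q : ℝ × ℝ => f q.1 q.2) (Ioc 0 a ×ˢ Ioc 0 b))
    (hα₂ : 0 < α₂) (hρ₂ : 0 < ρ₂) (hy : y ∈ Icc 0 b) :
    ContBdd (fun s => katIntE α₂ ρ₂ (f s) y) (Ioc 0 a) :=
  (hf.katIntE_param hα₂ hρ₂).slice_left (f := fun q : ℝ × ℝ => katIntE α₂ ρ₂ (f q.1) q.2) hy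

theorem katInt2_congr (hα₁ : 0 < α₁) (hα₂ : 0 < α₂) (hx : x ∈ Icc 0 a) (hy : y ∈ Icc 0 b)
    (h : ∀ s ∈ Ioc 0 a, ∀ t ∈ Ioc 0 b, f s t = g s t) :
    katInt2 α₁ α₂ ρ₁ ρ₂ f x y = katInt2 α₁ α₂ ρ₁ ρ₂ g x y :=
  katIntE_congr hα₁ hx.1 fun s hs => katIntE_congr hα₂ hy.1 fun t ht =>
    h s ⟨hs.1, hs.2.trans hx.2⟩ t ⟨ht.1, ht.2.trans hy.2⟩

theorem katInt2_congr_Icc (hα₁ : 0 ≤ α₁) (hα₂ : 0 ≤ α₂) (hx : x ∈ Icc 0 a) (hy : y ∈ Icc 0 b)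
    (h : ∀ s ∈ Icc 0 a, ∀ t ∈ Icc 0 b, f s t = g s t) :
    katInt2 α₁ α₂ ρ₁ ρ₂ f x y = katInt2 α₁ α₂ ρ₁ ρ₂ g x y :=
  katIntE_congr_Icc hα₁ hx.1 fun s hs => katIntE_congr_Icc hα₂ hy.1 fun t ht =>
    h s ⟨hs.1, hs.2.trans hx.2⟩ t ⟨ht.1, ht.2.trans hy.2⟩

theorem katIntE_zero_fun {α ρ x : ℝ} : katIntE α ρ (fun _ => (0 : E)) x = 0 := by
  simp [katIntE]

theorem katIntE_eq_zero {α ρ x : ℝ} {f : ℝ → E} (hα : 0 ≤ α) (hx : 0 ≤ x)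
    (h : ∀ s ∈ Icc 0 x, f s = 0) : katIntE α ρ f x = 0 :=
  (katIntE_congr_Icc (g := fun _ => (0 : E)) hα hx h).trans katIntE_zero_fun

theorem katIntE_at_zero_of_nonneg {α ρ : ℝ} {f : ℝ → E} (hα : 0 ≤ α) (h : f 0 = 0) :
    katIntE α ρ f 0 = 0 :=
  katIntE_eq_zero hα le_rfl fun s hs => by rw [le_antisymm hs.2 hs.1, h]

theorem katInt2_left_zero (hα₁ : 0 < α₁) : katInt2 α₁ α₂ ρ₁ ρ₂ f 0 y = 0 :=
  katIntE_at_zero hα₁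

theorem katInt2_right_zero (hα₂ : 0 < α₂) : katInt2 α₁ α₂ ρ₁ ρ₂ f x 0 = 0 := by
  simp only [katInt2, katIntE_at_zero hα₂, katIntE_zero_fun]

theorem katInt2_left_zero_of_nonneg (hα₁ : 0 ≤ α₁) (hα₂ : 0 ≤ α₂) (hy : y ∈ Icc 0 b)
    (h : ∀ t ∈ Icc 0 b, f 0 t = 0) : katInt2 α₁ α₂ ρ₁ ρ₂ f 0 y = 0 :=
  katIntE_at_zero_of_nonneg hα₁ (katIntE_eq_zero hα₂ hy.1 fun t ht => h t ⟨ht.1, ht.2.trans hy.2⟩)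

theorem katInt2_right_zero_of_nonneg (hα₁ : 0 ≤ α₁) (hα₂ : 0 ≤ α₂) (hx : x ∈ Icc 0 a)
    (h : ∀ s ∈ Icc 0 a, f s 0 = 0) : katInt2 α₁ α₂ ρ₁ ρ₂ f x 0 = 0 :=
  katIntE_eq_zero hα₁ hx.1 fun s hs =>
    katIntE_at_zero_of_nonneg hα₂ (h s ⟨hs.1, hs.2.trans hx.2⟩)

theorem ContBdd.clm_katInt2 [CompleteSpace E] [CompleteSpace F]
    (hf : ContBdd (fun q : ℝ × ℝ => f q.1 q.2) (Ioc 0 a ×ˢ Ioc 0 b)) (L : E →L[ℝ] F)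
    (hα₁ : 0 < α₁) (hα₂ : 0 < α₂) (hρ₁ : 0 < ρ₁) (hρ₂ : 0 < ρ₂)
    (hx : x ∈ Icc 0 a) (hy : y ∈ Icc 0 b) :
    L (katInt2 α₁ α₂ ρ₁ ρ₂ f x y) = katInt2 α₁ α₂ ρ₁ ρ₂ (fun s t => L (f s t)) x y := by
  rw [katInt2, (hf.inner_katIntE hα₂ hρ₂ hy).clm_katIntE L hα₁ hρ₁ hx]
  refine katIntE_congr hα₁ hx.1 fun s hs => ?_
  exact (hf.slice_right (p := s) ⟨hs.1, hs.2.trans hx.2⟩).clm_katIntE L hα₂ hρ₂ hy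

theorem rpow_div_rpow_le {α ρ : ℝ} (hα : 0 < α) (hρ : 0 < ρ) (hx : x ∈ Icc 0 a) :
    (x ^ ρ / ρ) ^ α ≤ (a ^ ρ / ρ) ^ α :=
  Real.rpow_le_rpow (div_nonneg (Real.rpow_nonneg hx.1 _) hρ.le)
    (div_le_div_of_nonneg_right (Real.rpow_le_rpow hx.1 hx.2 hρ.le) hρ.le) hα.le

/-- With `C = R * dist`, the right-hand side is `Ξ` times the distance: this is the contraction
estimate. -/
theorem ContBdd.norm_katInt2_sub_le
    (hf : ContBdd (fun q : ℝ × ℝ => f q.1 q.2) (Ioc 0 a ×ˢ Ioc 0 b))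
    (hg : ContBdd (fun q : ℝ × ℝ => g q.1 q.2) (Ioc 0 a ×ˢ Ioc 0 b))
    (hα₁ : 0 < α₁) (hα₂ : 0 < α₂) (hρ₁ : 0 < ρ₁) (hρ₂ : 0 < ρ₂)
    (hx : x ∈ Icc 0 a) (hy : y ∈ Icc 0 b) {C : ℝ} (hC0 : 0 ≤ C)
    (hC : ∀ s ∈ Ioc 0 a, ∀ t ∈ Ioc 0 b, ‖f s t - g s t‖ ≤ C) :
    ‖katInt2 α₁ α₂ ρ₁ ρ₂ f x y - katInt2 α₁ α₂ ρ₁ ρ₂ g x y‖ ≤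
      (a ^ ρ₁ / ρ₁) ^ α₁ / Real.Gamma (α₁ + 1) *
        ((b ^ ρ₂ / ρ₂) ^ α₂ / Real.Gamma (α₂ + 1) * C) := by
  have hΓ₁ : 0 < Real.Gamma (α₁ + 1) := Real.Gamma_pos_of_pos (by linarith)
  have hΓ₂ : 0 < Real.Gamma (α₂ + 1) := Real.Gamma_pos_of_pos (by linarith)
  have h1 := rpow_div_rpow_le hα₁ hρ₁ hx
  have h2 := rpow_div_rpow_le hα₂ hρ₂ hy
  have hb0 : 0 ≤ (b ^ ρ₂ / ρ₂) ^ α₂ := Real.rpow_nonneg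
    (div_nonneg (Real.rpow_nonneg (hy.1.trans hy.2) _) hρ₂.le) _
  rw [katInt2, katInt2, (hf.inner_katIntE hα₂ hρ₂ hy).katIntE_sub
    (hg.inner_katIntE hα₂ hρ₂ hy) hα₁ hρ₁ hx]
  refine (norm_katIntE_le hα₁ hρ₁ hx.1 (C := (b ^ ρ₂ / ρ₂) ^ α₂ / Real.Gamma (α₂ + 1) * C)
    fun s hs => ?_).trans ?_
  · have hs' : s ∈ Ioc 0 a := ⟨hs.1, hs.2.trans hx.2⟩
    rw [(hf.slice_right (p := s) hs').katIntE_sub (hg.slice_right (p := s) hs') hα₂ hρ₂ hy]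
    refine (norm_katIntE_le hα₂ hρ₂ hy.1 fun t ht =>
      hC s hs' t ⟨ht.1, ht.2.trans hy.2⟩).trans ?_
    gcongr
  · gcongr

theorem ContBdd.hasDerivWithinAt_katInt2_left [CompleteSpace E]
    (hf : ContBdd (fun q : ℝ × ℝ => f q.1 q.2) (Ioc 0 a ×ˢ Ioc 0 b))
    (hρ₁ : 0 < ρ₁) (hρ₂ : 0 < ρ₂) (hx : x ∈ Ioc 0 a) (hy : y ∈ Icc 0 b) :
    HasDerivWithinAt (fun s => katInt2 1 1 ρ₁ ρ₂ f s y)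
      (x ^ (ρ₁ - 1) • katIntE 1 ρ₂ (f x) y) (Ioc 0 a) x :=
  (hf.inner_katIntE one_pos hρ₂ hy).hasDerivWithinAt_katIntE_one hρ₁ hx

theorem ContBdd.hasDerivWithinAt_katInt2_right [CompleteSpace E]
    (hf : ContBdd (fun q : ℝ × ℝ => f q.1 q.2) (Ioc 0 a ×ˢ Ioc 0 b))
    (hρ₂ : 0 < ρ₂) (hx : x ∈ Ioc 0 a) (hy : y ∈ Ioc 0 b) :
    HasDerivWithinAt (fun t => x ^ (ρ₁ - 1) • katIntE 1 ρ₂ (f x) t)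
      ((x ^ (ρ₁ - 1) * y ^ (ρ₂ - 1)) • f x y) (Ioc 0 b) y := by
  rw [mul_smul]
  exact ((hf.slice_right (p := x) hx).hasDerivWithinAt_katIntE_one hρ₂ hy).const_smul _

end KatInt2

/-! ### Mixed integrals of real functions: semigroup, injectivity, mixed derivatives -/

section Real

variable {φ₁ φ₂ ρ₁ ρ₂ a b x y : ℝ} {f g : ℝ → ℝ → ℝ}

theorem ContBdd.katInt2_mono (hf : ContBdd (fun q : ℝ × ℝ => f q.1 q.2) (Ioc 0 a ×ˢ Ioc 0 b))
    (hg : ContBdd (fun q : ℝ × ℝ => g q.1 q.2) (Ioc 0 a ×ˢ Ioc 0 b))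
    (hφ₁ : 0 < φ₁) (hφ₂ : 0 < φ₂) (hρ₁ : 0 < ρ₁) (hρ₂ : 0 < ρ₂)
    (hx : x ∈ Icc 0 a) (hy : y ∈ Icc 0 b)
    (h : ∀ s ∈ Ioc 0 a, ∀ t ∈ Ioc 0 b, f s t ≤ g s t) :
    katInt2 φ₁ φ₂ ρ₁ ρ₂ f x y ≤ katInt2 φ₁ φ₂ ρ₁ ρ₂ g x y :=
  (hf.inner_katIntE hφ₂ hρ₂ hy).katIntE_mono (hg.inner_katIntE hφ₂ hρ₂ hy) hφ₁ hρ₁ hx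
    fun s hs => (hf.slice_right (p := s) hs).katIntE_mono (hg.slice_right (p := s) hs) hφ₂ hρ₂ hy
      fun t ht => h s hs t ht

/-- The `y`-integral of order `1 - φ₂` is moved past the `x`-integral of order `φ₁` by Fubini, after
which the one-variable semigroup law applies in each variable. Order `0` occurs when some `φᵢ = 1`
and is the identity. -/
theorem ContBdd.katInt2_katInt2
    (hf : ContBdd (fun q : ℝ × ℝ => f q.1 q.2) (Ioc 0 a ×ˢ Ioc 0 b))
    (hφ₁ : φ₁ ∈ Ioc (0 : ℝ) 1) (hφ₂ : φ₂ ∈ Ioc (0 : ℝ) 1) (hρ₁ : 0 < ρ₁) (hρ₂ : 0 < ρ₂)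
    (hx : x ∈ Icc 0 a) (hy : y ∈ Icc 0 b) :
    katInt2 (1 - φ₁) (1 - φ₂) ρ₁ ρ₂ (katInt2 φ₁ φ₂ ρ₁ ρ₂ f) x y = katInt2 1 1 ρ₁ ρ₂ f x y := by
  have hK : ContBdd (fun q : ℝ × ℝ => katIntE φ₂ ρ₂ (f q.1) q.2) (Ioc 0 a ×ˢ Ioc 0 b) :=
    (hf.katIntE_param hφ₂.1 hρ₂).mono (prod_mono_right Ioc_subset_Icc_self)
  have h1 : ∀ s ∈ Icc 0 a, katIntE (1 - φ₂) ρ₂ (katInt2 φ₁ φ₂ ρ₁ ρ₂ f s) y =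
      katIntE φ₁ ρ₁ (fun s' => katIntE 1 ρ₂ (f s') y) s := by
    intro s hs
    have h2 : katIntE (1 - φ₂) ρ₂ (katInt2 φ₁ φ₂ ρ₁ ρ₂ f s) y =
        katIntE φ₁ ρ₁ (fun s' => katIntE (1 - φ₂) ρ₂ (katIntE φ₂ ρ₂ (f s')) y) s := by
      rcases hφ₂.2.eq_or_lt with h | h
      · rw [h, sub_self]
        simp only [katIntE_zero_order]
        rfl
      · exact ContBdd.katIntE_comm (H := fun s t => katIntE φ₂ ρ₂ (f s) t) hK hφ₁.1
          (sub_pos.2 h) hρ₁ hρ₂ hs hy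
    rw [h2]
    exact katIntE_congr hφ₁.1 hs.1 fun s' hs' =>
      (hf.slice_right (p := s') ⟨hs'.1, hs'.2.trans hs.2⟩).katIntE_katIntE hφ₂ hρ₂ hy
  rw [katInt2, katIntE_congr_Icc (sub_nonneg.2 hφ₁.2) hx.1 fun s hs =>
    h1 s ⟨hs.1, hs.2.trans hx.2⟩]
  exact (hf.inner_katIntE one_pos hρ₂ hy).katIntE_katIntE hφ₁ hρ₁ hx

/-- For each fixed `y` the outer `x`-integral is cancelled first, then for each fixed `x` the inner
`y`-integral. -/
theorem katInt2_injOn (hf : ContBdd (fun q : ℝ × ℝ => f q.1 q.2) (Icc 0 a ×ˢ Icc 0 b))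
    (hg : ContBdd (fun q : ℝ × ℝ => g q.1 q.2) (Icc 0 a ×ˢ Icc 0 b))
    (hφ₁ : φ₁ ∈ Ioc (0 : ℝ) 1) (hφ₂ : φ₂ ∈ Ioc (0 : ℝ) 1) (hρ₁ : 0 < ρ₁) (hρ₂ : 0 < ρ₂)
    (h : ∀ x ∈ Icc 0 a, ∀ y ∈ Icc 0 b,
      katInt2 (1 - φ₁) (1 - φ₂) ρ₁ ρ₂ f x y = katInt2 (1 - φ₁) (1 - φ₂) ρ₁ ρ₂ g x y) :
    ∀ x ∈ Ioc 0 a, ∀ y ∈ Ioc 0 b, f x y = g x y := by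
  have h2 := sub_nonneg.2 hφ₂.2
  intro x hx y hy
  have hx' : x ∈ Icc 0 a := Ioc_subset_Icc_self hx
  refine katIntE_injOn ((hf.slice_right (p := x) hx').mono Ioc_subset_Icc_self)
    ((hg.slice_right (p := x) hx').mono Ioc_subset_Icc_self) hφ₂ hρ₂ (fun y hy => ?_) hy
  exact katIntE_injOn (((hf.katIntE_param_of_nonneg h2 hρ₂).slice_left
      (f := fun q : ℝ × ℝ => katIntE (1 - φ₂) ρ₂ (f q.1) q.2) hy).mono Ioc_subset_Icc_self)
    (((hg.katIntE_param_of_nonneg h2 hρ₂).slice_left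
      (f := fun q : ℝ × ℝ => katIntE (1 - φ₂) ρ₂ (g q.1) q.2) hy).mono Ioc_subset_Icc_self)
    hφ₁ hρ₁ (fun x hx => h x hx y hy) hx

theorem eq_of_hasDerivWithinAt_zero {u : ℝ → ℝ}
    (h : ∀ x ∈ Ioc 0 a, HasDerivWithinAt u 0 (Ioc 0 a) x) {x x' : ℝ} (hx : x ∈ Ioc 0 a)
    (hx' : x' ∈ Ioc 0 a) : u x = u x' := by
  have := (convex_Ioc 0 a).norm_image_sub_le_of_norm_hasDerivWithin_le (f' := fun _ => 0)
    (C := 0) h (by simp) hx' hx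
  rw [zero_mul] at this
  exact sub_eq_zero.1 (norm_le_zero_iff.1 this)

theorem eq_left_of_const {u : ℝ → ℝ} {c : ℝ} (ha : 0 < a) (hu : ContinuousOn u (Icc 0 a))
    (h : ∀ x ∈ Ioc 0 a, u x = c) : u 0 = c := by
  have h1 : Tendsto u (𝓝[Ioc 0 a] 0) (𝓝 (u 0)) :=
    (hu 0 ⟨le_rfl, ha.le⟩).mono Ioc_subset_Icc_self
  have h2 : Tendsto u (𝓝[Ioc 0 a] 0) (𝓝 c) :=
    tendsto_const_nhds.congr' (eventually_nhdsWithin_of_forall fun x hx => (h x hx).symm)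
  rw [nhdsWithin_Ioc_eq_nhdsGT ha] at h1 h2
  exact tendsto_nhds_unique h1 h2

/-- Since `p x` is constant in `y`, the difference `Z s y' - Z s y` has zero `s`-derivative, so it
equals its limit `0` at `s = 0`. Hence `Z x` is constant on `(0, b]`, with limit `0` at `y = 0`.
Derivatives are known only off the axes, so continuity on the closed rectangle is what brings in the
boundary values; no regularity of `p` in `x` is needed. -/
theorem eq_zero_of_mixed_deriv_zero {Z p : ℝ → ℝ → ℝ} (ha : 0 < a) (hb : 0 < b)
    (hZ : ContinuousOn (fun q : ℝ × ℝ => Z q.1 q.2) (Icc 0 a ×ˢ Icc 0 b))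
    (h0y : ∀ y ∈ Icc 0 b, Z 0 y = 0) (hx0 : ∀ x ∈ Icc 0 a, Z x 0 = 0)
    (hp : ∀ x ∈ Ioc 0 a, ∀ y ∈ Ioc 0 b,
      HasDerivWithinAt (fun s => Z s y) (p x y) (Ioc 0 a) x)
    (hq : ∀ x ∈ Ioc 0 a, ∀ y ∈ Ioc 0 b, HasDerivWithinAt (fun t => p x t) 0 (Ioc 0 b) y)
    (hx : x ∈ Ioc 0 a) (hy : y ∈ Ioc 0 b) : Z x y = 0 := by
  have hcx : ∀ y ∈ Icc 0 b, ContinuousOn (fun s => Z s y) (Icc 0 a) := fun y hy =>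
    hZ.comp (f := fun s => (s, y)) (by fun_prop) fun s hs => ⟨hs, hy⟩
  have hcy : ∀ x ∈ Icc 0 a, ContinuousOn (fun t => Z x t) (Icc 0 b) := fun x hx =>
    hZ.comp (f := fun t => (x, t)) (by fun_prop) fun t ht => ⟨hx, ht⟩
  have key : ∀ y' ∈ Ioc 0 b, Z x y' = Z x y := by
    intro y' hy'
    have hD : ∀ s ∈ Ioc 0 a, HasDerivWithinAt (fun s => Z s y' - Z s y) 0 (Ioc 0 a) s := by
      intro s hs
      have := (hp s hs y' hy').sub (hp s hs y hy)
      rwa [eq_of_hasDerivWithinAt_zero (hq s hs) hy' hy, sub_self] at this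
    have h1 := eq_left_of_const ha ((hcx y' (Ioc_subset_Icc_self hy')).sub
      (hcx y (Ioc_subset_Icc_self hy))) fun s hs => eq_of_hasDerivWithinAt_zero hD hs hx
    simp only [h0y y' (Ioc_subset_Icc_self hy'), h0y y (Ioc_subset_Icc_self hy),
      Pi.sub_apply, sub_zero] at h1
    linarith
  rw [← eq_left_of_const hb (hcy x (Ioc_subset_Icc_self hx)) key]
  exact hx0 x (Ioc_subset_Icc_self hx)

/-- A function with vanishing boundary values is the integral of its mixed derivative. -/
theorem eq_katInt2_of_mixed_deriv {U p : ℝ → ℝ → ℝ} (ha : 0 < a) (hb : 0 < b)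
    (hρ₁ : 0 < ρ₁) (hρ₂ : 0 < ρ₂)
    (hg : ContBdd (fun q : ℝ × ℝ => g q.1 q.2) (Ioc 0 a ×ˢ Ioc 0 b))
    (hU : ContinuousOn (fun q : ℝ × ℝ => U q.1 q.2) (Icc 0 a ×ˢ Icc 0 b))
    (h0y : ∀ y ∈ Icc 0 b, U 0 y = 0) (hx0 : ∀ x ∈ Icc 0 a, U x 0 = 0)
    (hp : ∀ x ∈ Ioc 0 a, ∀ y ∈ Ioc 0 b,
      HasDerivWithinAt (fun s => U s y) (p x y) (Ioc 0 a) x)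
    (hq : ∀ x ∈ Ioc 0 a, ∀ y ∈ Ioc 0 b, HasDerivWithinAt (fun t => p x t)
      (x ^ (ρ₁ - 1) * y ^ (ρ₂ - 1) * g x y) (Ioc 0 b) y)
    (hx : x ∈ Icc 0 a) (hy : y ∈ Icc 0 b) : U x y = katInt2 1 1 ρ₁ ρ₂ g x y := by
  rcases hx.1.eq_or_lt with rfl | hx1
  · rw [h0y y hy, katInt2_left_zero one_pos]
  rcases hy.1.eq_or_lt with rfl | hy1
  · rw [hx0 x hx, katInt2_right_zero one_pos]
  refine sub_eq_zero.1 (eq_zero_of_mixed_deriv_zero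
    (Z := fun x y => U x y - katInt2 1 1 ρ₁ ρ₂ g x y)
    (p := fun x y => p x y - x ^ (ρ₁ - 1) • katIntE 1 ρ₂ (g x) y) ha hb
    (hU.sub (hg.contBdd_katInt2 one_pos one_pos hρ₁ hρ₂).1) ?_ ?_ ?_ ?_ ⟨hx1, hx.2⟩ ⟨hy1, hy.2⟩)
  · intro y hy
    rw [h0y y hy, katInt2_left_zero one_pos, sub_self]
  · intro x hx
    rw [hx0 x hx, katInt2_right_zero one_pos, sub_self]
  · intro x hx y hy
    exact (hp x hx y hy).sub
      (hg.hasDerivWithinAt_katInt2_left hρ₁ hρ₂ hx (Ioc_subset_Icc_self hy))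
  · intro x hx y hy
    have := (hq x hx y hy).sub (hg.hasDerivWithinAt_katInt2_right (ρ₁ := ρ₁) hρ₂ hx hy)
    rwa [smul_eq_mul, sub_self] at this

end Real

theorem EndPts.IsFuzzy.isFuzzy_katInt2 {f : ℝ → ℝ → EndPts} {α₁ α₂ ρ₁ ρ₂ a b x y : ℝ}
    (hα₁ : 0 < α₁) (hα₂ : 0 < α₂) (hρ₁ : 0 < ρ₁) (hρ₂ : 0 < ρ₂)
    (hx : x ∈ Icc 0 a) (hy : y ∈ Icc 0 b)
    (h : ∀ s ∈ Ioc 0 a, ∀ t ∈ Ioc 0 b, IsFuzzy (f s t)) :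
    IsFuzzy (katInt2 α₁ α₂ ρ₁ ρ₂ f x y) :=
  isFuzzy_katIntE hα₁ hρ₁ hx.1 fun s hs => isFuzzy_katIntE hα₂ hρ₂ hy.1 fun t ht =>
    h s ⟨hs.1, hs.2.trans hx.2⟩ t ⟨ht.1, ht.2.trans hy.2⟩

/-! ### Mixed gH-derivatives and fractional integrals of fuzzy functions -/

namespace EndPts

/-- The evaluations of the end points. -/
def evals : Set (EndPts →L[ℝ] ℝ) := range lowerL ∪ range upperL

theorem lowerL_mem_evals (r : Icc (0 : ℝ) 1) : lowerL r ∈ evals := Or.inl ⟨r, rfl⟩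

theorem upperL_mem_evals (r : Icc (0 : ℝ) 1) : upperL r ∈ evals := Or.inr ⟨r, rfl⟩

theorem forall_evals {p : (EndPts →L[ℝ] ℝ) → Prop} :
    (∀ L ∈ evals, p L) ↔ ∀ r, p (lowerL r) ∧ p (upperL r) := by
  simp only [evals, mem_union, or_imp, forall_and, forall_mem_range]

theorem ext_evals {e e' : EndPts} : e = e' ↔ ∀ L ∈ evals, L e = L e' := by
  rw [forall_evals]
  exact FuzzyHat.emb_ext_iff

end EndPts

namespace FuzzyHat

open EndPts

variable {φ₁ φ₂ ρ₁ ρ₂ a b x y : ℝ}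

theorem continuousOn_emb_iff {X : Type*} [TopologicalSpace X] {u : X → FuzzyHat} {S : Set X} :
    ContinuousOn (fun q => emb (u q)) S ↔ ContinuousOn u S :=
  (isometry_emb.isUniformInducing.isInducing.continuousOn_iff).symm

theorem isKatInt_iff_evals {α₁ α₂ : ℝ} {u : ℝ → ℝ → FuzzyHat} {J : FuzzyHat} :
    IsKatInt α₁ α₂ ρ₁ ρ₂ u x y J ↔ ∀ L ∈ evals,
      L (emb J) = katInt2 α₁ α₂ ρ₁ ρ₂ (fun s t => L (emb (u s t))) x y := by
  rw [forall_evals, isKatInt_iff]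
  rfl

theorem isKatInt_iff_emb {α₁ α₂ : ℝ} {u : ℝ → ℝ → FuzzyHat} {J : FuzzyHat}
    (hu : ContBdd (fun q : ℝ × ℝ => emb (u q.1 q.2)) (Ioc 0 a ×ˢ Ioc 0 b))
    (hα₁ : 0 < α₁) (hα₂ : 0 < α₂) (hρ₁ : 0 < ρ₁) (hρ₂ : 0 < ρ₂)
    (hx : x ∈ Icc 0 a) (hy : y ∈ Icc 0 b) :
    IsKatInt α₁ α₂ ρ₁ ρ₂ u x y J ↔
      emb J = katInt2 α₁ α₂ ρ₁ ρ₂ (fun s t => emb (u s t)) x y := by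
  rw [isKatInt_iff_evals, ext_evals]
  refine forall₂_congr fun L _ => ?_
  rw [ContBdd.clm_katInt2 (f := fun s t => emb (u s t)) hu L hα₁ hα₂ hρ₁ hρ₂ hx hy]

/-- A function with vanishing boundary values and a mixed gH-derivative without switching points is
the integral of that derivative, whatever the types. -/
theorem emb_eq_katInt2_of_hasMixedGHDeriv {U Q G : ℝ → ℝ → FuzzyHat} (ha : 0 < a) (hb : 0 < b)
    (hρ₁ : 0 < ρ₁) (hρ₂ : 0 < ρ₂)
    (hG : ContBdd (fun q : ℝ × ℝ => emb (G q.1 q.2)) (Ioc 0 a ×ˢ Ioc 0 b))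
    (hUQ : HasMixedGHDeriv a b U Q)
    (hQ : ∀ x ∈ Ioc 0 a, ∀ y ∈ Ioc 0 b,
      emb (Q x y) = (x ^ (ρ₁ - 1) * y ^ (ρ₂ - 1)) • emb (G x y))
    (hU : ∀ L ∈ evals, ContinuousOn (fun q : ℝ × ℝ => L (emb (U q.1 q.2))) (Icc 0 a ×ˢ Icc 0 b))
    (h0y : ∀ L ∈ evals, ∀ y ∈ Icc 0 b, L (emb (U 0 y)) = 0)
    (hx0 : ∀ L ∈ evals, ∀ x ∈ Icc 0 a, L (emb (U x 0)) = 0)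
    (hx : x ∈ Icc 0 a) (hy : y ∈ Icc 0 b) :
    emb (U x y) = katInt2 1 1 ρ₁ ρ₂ (fun s t => emb (G s t)) x y := by
  obtain ⟨P, T₁, T₂, -, -, hD⟩ := hUQ
  -- Here `L` picks an end point of `U` and `L'` the end point of `Q` reached after both
  -- differentiations; `p` is the intermediate end point of `∂U/∂x`.
  have key : ∀ L ∈ evals, ∀ L' ∈ evals, ∀ p : ℝ → ℝ → ℝ,
      (∀ x ∈ Ioc 0 a, ∀ y ∈ Ioc 0 b,
        HasDerivWithinAt (fun s => L (emb (U s y))) (p x y) (Ioc 0 a) x) →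
      (∀ x ∈ Ioc 0 a, ∀ y ∈ Ioc 0 b,
        HasDerivWithinAt (fun t => p x t) (L' (emb (Q x y))) (Ioc 0 b) y) →
      L (emb (U x y)) = katInt2 1 1 ρ₁ ρ₂ (fun s t => L' (emb (G s t))) x y := by
    intro L hL L' _ p hp hq
    refine eq_katInt2_of_mixed_deriv (U := fun x y => L (emb (U x y))) (p := p) ha hb hρ₁ hρ₂
      (hG.clm L') (hU L hL) (h0y L hL) (hx0 L hL) hp (fun x hx y hy => ?_) hx hy
    have := hq x hx y hy
    rwa [hQ x hx y hy, map_smul] at this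
  -- In the crossed case, `lower U = I upper G ≥ I lower G = upper U ≥ lower U`, so all four values
  -- coincide and the crossing has no effect.
  have crossed : (∀ r, lowerL r (emb (U x y)) =
        katInt2 1 1 ρ₁ ρ₂ (fun s t => upperL r (emb (G s t))) x y ∧
      upperL r (emb (U x y)) =
        katInt2 1 1 ρ₁ ρ₂ (fun s t => lowerL r (emb (G s t))) x y) →
      emb (U x y) = katInt2 1 1 ρ₁ ρ₂ (fun s t => emb (G s t)) x y := by
    intro h
    rw [ext_evals, forall_evals]
    intro r
    rw [ContBdd.clm_katInt2 (f := fun s t => emb (G s t)) hG _ one_pos one_pos hρ₁ hρ₂ hx hy,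
      ContBdd.clm_katInt2 (f := fun s t => emb (G s t)) hG _ one_pos one_pos hρ₁ hρ₂ hx hy]
    have h1 : lowerL r (emb (U x y)) ≤ upperL r (emb (U x y)) := (isFuzzy_emb _).le r
    have h2 := ContBdd.katInt2_mono (φ₁ := 1) (φ₂ := 1) (f := fun s t => lowerL r (emb (G s t)))
      (g := fun s t => upperL r (emb (G s t)))
      (hG.clm (lowerL r)) (hG.clm (upperL r)) one_pos one_pos hρ₁ hρ₂ hx hy
      fun s _ t _ => (isFuzzy_emb (G s t)).le r
    obtain ⟨h3, h4⟩ := h r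
    constructor <;> linarith
  have direct : (∀ r, lowerL r (emb (U x y)) =
        katInt2 1 1 ρ₁ ρ₂ (fun s t => lowerL r (emb (G s t))) x y ∧
      upperL r (emb (U x y)) =
        katInt2 1 1 ρ₁ ρ₂ (fun s t => upperL r (emb (G s t))) x y) →
      emb (U x y) = katInt2 1 1 ρ₁ ρ₂ (fun s t => emb (G s t)) x y := by
    intro h
    rw [ext_evals, forall_evals]
    intro r
    rw [ContBdd.clm_katInt2 (f := fun s t => emb (G s t)) hG _ one_pos one_pos hρ₁ hρ₂ hx hy,
      ContBdd.clm_katInt2 (f := fun s t => emb (G s t)) hG _ one_pos one_pos hρ₁ hρ₂ hx hy]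
    exact h r
  -- Each type (ii) swaps the end points once: equal types restore the order, different types cross
  -- it.
  cases T₁ <;> cases T₂
  · refine direct fun r => ⟨?_, ?_⟩
    · exact key _ (lowerL_mem_evals r) _ (lowerL_mem_evals r) (fun x y => lowerL r (emb (P x y)))
        (fun x hx y hy => ((hD x hx y hy).1.2 r r.2).1)
        (fun x hx y hy => ((hD x hx y hy).2.2 r r.2).1)
    · exact key _ (upperL_mem_evals r) _ (upperL_mem_evals r) (fun x y => upperL r (emb (P x y)))
        (fun x hx y hy => ((hD x hx y hy).1.2 r r.2).2)
        (fun x hx y hy => ((hD x hx y hy).2.2 r r.2).2)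
  · refine crossed fun r => ⟨?_, ?_⟩
    · exact key _ (lowerL_mem_evals r) _ (upperL_mem_evals r) (fun x y => lowerL r (emb (P x y)))
        (fun x hx y hy => ((hD x hx y hy).1.2 r r.2).1)
        (fun x hx y hy => ((hD x hx y hy).2.2 r r.2).2)
    · exact key _ (upperL_mem_evals r) _ (lowerL_mem_evals r) (fun x y => upperL r (emb (P x y)))
        (fun x hx y hy => ((hD x hx y hy).1.2 r r.2).2)
        (fun x hx y hy => ((hD x hx y hy).2.2 r r.2).1)
  · refine crossed fun r => ⟨?_, ?_⟩
    · exact key _ (lowerL_mem_evals r) _ (upperL_mem_evals r) (fun x y => upperL r (emb (P x y)))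
        (fun x hx y hy => ((hD x hx y hy).1.2 r r.2).2)
        (fun x hx y hy => ((hD x hx y hy).2.2 r r.2).2)
    · exact key _ (upperL_mem_evals r) _ (lowerL_mem_evals r) (fun x y => lowerL r (emb (P x y)))
        (fun x hx y hy => ((hD x hx y hy).1.2 r r.2).1)
        (fun x hx y hy => ((hD x hx y hy).2.2 r r.2).1)
  · refine direct fun r => ⟨?_, ?_⟩
    · exact key _ (lowerL_mem_evals r) _ (lowerL_mem_evals r) (fun x y => upperL r (emb (P x y)))
        (fun x hx y hy => ((hD x hx y hy).1.2 r r.2).2)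
        (fun x hx y hy => ((hD x hx y hy).2.2 r r.2).1)
    · exact key _ (upperL_mem_evals r) _ (upperL_mem_evals r) (fun x y => lowerL r (emb (P x y)))
        (fun x hx y hy => ((hD x hx y hy).1.2 r r.2).1)
        (fun x hx y hy => ((hD x hx y hy).2.2 r r.2).2)

theorem rpow_one_sub_mul {ρ : ℝ} (hx : 0 < x) : x ^ (1 - ρ) * x ^ (ρ - 1) = 1 := by
  rw [← Real.rpow_add hx, show 1 - ρ + (ρ - 1) = 0 by ring, Real.rpow_zero]

theorem isSMul_rpow_iff {V Q : FuzzyHat} (hx : 0 < x) (hy : 0 < y) :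
    IsSMul V (x ^ (1 - ρ₁) * y ^ (1 - ρ₂)) Q ↔
      emb Q = (x ^ (ρ₁ - 1) * y ^ (ρ₂ - 1)) • emb V := by
  have h1 := rpow_one_sub_mul (ρ := ρ₁) hx
  have h2 := rpow_one_sub_mul (ρ := ρ₂) hy
  rw [isSMul_iff (mul_pos (Real.rpow_pos_of_pos hx _) (Real.rpow_pos_of_pos hy _))]
  constructor
  · intro h
    rw [h, smul_smul, show x ^ (ρ₁ - 1) * y ^ (ρ₂ - 1) * (x ^ (1 - ρ₁) * y ^ (1 - ρ₂)) = 1 by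
      linear_combination h1 * (y ^ (1 - ρ₂) * y ^ (ρ₂ - 1)) + h2, one_smul]
  · intro h
    rw [h, smul_smul, show x ^ (1 - ρ₁) * y ^ (1 - ρ₂) * (x ^ (ρ₁ - 1) * y ^ (ρ₂ - 1)) = 1 by
      linear_combination h1 * (y ^ (1 - ρ₂) * y ^ (ρ₂ - 1)) + h2, one_smul]

/-- A function vanishing on the axes is the fractional integral of its Katugampola derivative. -/
theorem HasKatDeriv.emb_eq_katInt2 {w G : ℝ → ℝ → FuzzyHat} (ha : 0 < a) (hb : 0 < b)
    (hφ₁ : φ₁ ∈ Ioc (0 : ℝ) 1) (hφ₂ : φ₂ ∈ Ioc (0 : ℝ) 1) (hρ₁ : 0 < ρ₁) (hρ₂ : 0 < ρ₂)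
    (hG : ContBdd (fun q : ℝ × ℝ => emb (G q.1 q.2)) (Ioc 0 a ×ˢ Ioc 0 b))
    (hw : ContinuousOn (fun q : ℝ × ℝ => emb (w q.1 q.2)) (Icc 0 a ×ˢ Icc 0 b))
    (h0y : ∀ y ∈ Icc 0 b, emb (w 0 y) = 0) (hx0 : ∀ x ∈ Icc 0 a, emb (w x 0) = 0)
    (h : HasKatDeriv φ₁ φ₂ ρ₁ ρ₂ a b w G) (hx : x ∈ Icc 0 a) (hy : y ∈ Icc 0 b) :
    emb (w x y) = katInt2 φ₁ φ₂ ρ₁ ρ₂ (fun s t => emb (G s t)) x y := by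
  obtain ⟨U, Q, hU, hUQ, hQ⟩ := h
  have h1 := sub_nonneg.2 hφ₁.2
  have h2 := sub_nonneg.2 hφ₂.2
  have hwb := ContBdd.of_isCompact hw (isCompact_Icc.prod isCompact_Icc)
  have hUL : ∀ L ∈ evals, ∀ x ∈ Icc 0 a, ∀ y ∈ Icc 0 b, L (emb (U x y)) =
      katInt2 (1 - φ₁) (1 - φ₂) ρ₁ ρ₂ (fun s t => L (emb (w s t))) x y :=
    fun L hL x hx y hy => isKatInt_iff_evals.1 (hU x hx y hy) L hL
  have hUeq : ∀ x ∈ Icc 0 a, ∀ y ∈ Icc 0 b,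
      emb (U x y) = katInt2 1 1 ρ₁ ρ₂ (fun s t => emb (G s t)) x y := by
    intro x hx y hy
    refine emb_eq_katInt2_of_hasMixedGHDeriv ha hb hρ₁ hρ₂ hG hUQ (fun x hx y hy =>
      (isSMul_rpow_iff hx.1 hy.1).1 (hQ x hx y hy)) (fun L hL => ?_) (fun L hL y hy => ?_)
      (fun L hL x hx => ?_) hx hy
    · exact (ContBdd.contBdd_katInt2_of_nonneg (f := fun s t => L (emb (w s t))) (hwb.clm L)
        h1 h2 hρ₁ hρ₂).1.congr fun q hq => hUL L hL q.1 hq.1 q.2 hq.2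
    · rw [hUL L hL 0 ⟨le_rfl, ha.le⟩ y hy]
      exact katInt2_left_zero_of_nonneg h1 h2 hy fun t ht => by rw [h0y t ht, map_zero]
    · rw [hUL L hL x hx 0 ⟨le_rfl, hb.le⟩]
      exact katInt2_right_zero_of_nonneg h1 h2 hx fun t ht => by rw [hx0 t ht, map_zero]
  -- Injectivity gives equality only for `x, y > 0`; on the axes both sides vanish.
  rcases hx.1.eq_or_lt with rfl | hx1
  · rw [h0y y hy, katInt2_left_zero hφ₁.1]
  rcases hy.1.eq_or_lt with rfl | hy1
  · rw [hx0 x hx, katInt2_right_zero hφ₂.1]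
  rw [ext_evals]
  intro L hL
  rw [ContBdd.clm_katInt2 (f := fun s t => emb (G s t)) hG _ hφ₁.1 hφ₂.1 hρ₁ hρ₂ hx hy]
  have hGL : ContBdd (fun q : ℝ × ℝ => (fun s t => L (emb (G s t))) q.1 q.2)
    (Ioc 0 a ×ˢ Ioc 0 b) := hG.clm L
  -- The two sides agree after applying `I^{1-φ}`, since `I^{1-φ} w = U = I^1 G = I^{1-φ} I^φ G`.
  refine katInt2_injOn (f := fun s t => L (emb (w s t))) (hwb.clm L)
    (hGL.contBdd_katInt2 hφ₁.1 hφ₂.1 hρ₁ hρ₂) hφ₁ hφ₂ hρ₁ hρ₂ (fun x hx y hy => ?_)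
    x ⟨hx1, hx.2⟩ y ⟨hy1, hy.2⟩
  rw [hGL.katInt2_katInt2 hφ₁ hφ₂ hρ₁ hρ₂ hx hy, ← hUL L hL x hx y hy, hUeq x hx y hy,
    ContBdd.clm_katInt2 (f := fun s t => emb (G s t)) hG _ one_pos one_pos hρ₁ hρ₂ hx hy]

/-- The fractional integral of `G` has the Katugampola derivative `G`. -/
theorem hasKatDeriv_of_emb_eq {w G : ℝ → ℝ → FuzzyHat}
    (hφ₁ : φ₁ ∈ Ioc (0 : ℝ) 1) (hφ₂ : φ₂ ∈ Ioc (0 : ℝ) 1) (hρ₁ : 0 < ρ₁) (hρ₂ : 0 < ρ₂)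
    (hG : ContBdd (fun q : ℝ × ℝ => emb (G q.1 q.2)) (Ioc 0 a ×ˢ Ioc 0 b))
    (hw : ∀ x ∈ Icc 0 a, ∀ y ∈ Icc 0 b,
      emb (w x y) = katInt2 φ₁ φ₂ ρ₁ ρ₂ (fun s t => emb (G s t)) x y) :
    HasKatDeriv φ₁ φ₂ ρ₁ ρ₂ a b w G := by
  set g : ℝ → ℝ → EndPts := fun s t => emb (G s t) with hg
  have hg' : ContBdd (fun q : ℝ × ℝ => g q.1 q.2) (Ioc 0 a ×ˢ Ioc 0 b) := hG
  have hgf : ∀ s ∈ Ioc 0 a, ∀ t ∈ Ioc 0 b, IsFuzzy (g s t) := fun s _ t _ => isFuzzy_emb _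
  have hU : ∀ x ∈ Icc 0 a, ∀ y ∈ Icc 0 b, emb (ofEndPts (katInt2 1 1 ρ₁ ρ₂ g x y)) =
      katInt2 1 1 ρ₁ ρ₂ g x y := fun x hx y hy =>
    emb_ofEndPts (IsFuzzy.isFuzzy_katInt2 one_pos one_pos hρ₁ hρ₂ hx hy hgf)
  have hP : ∀ x ∈ Ioc 0 a, ∀ y ∈ Icc 0 b,
      emb (ofEndPts (x ^ (ρ₁ - 1) • katIntE 1 ρ₂ (g x) y)) =
        x ^ (ρ₁ - 1) • katIntE 1 ρ₂ (g x) y := fun x hx y hy =>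
    emb_ofEndPts ((IsFuzzy.isFuzzy_katIntE one_pos hρ₂ hy.1 fun t ht =>
      hgf x hx t ⟨ht.1, ht.2.trans hy.2⟩).smul (Real.rpow_nonneg hx.1.le _))
  have hQ : ∀ x ∈ Ioc 0 a, ∀ y ∈ Ioc 0 b,
      emb (ofEndPts ((x ^ (ρ₁ - 1) * y ^ (ρ₂ - 1)) • g x y)) =
        (x ^ (ρ₁ - 1) * y ^ (ρ₂ - 1)) • g x y := fun x hx y hy =>
    emb_ofEndPts ((hgf x hx y hy).smul
      (mul_nonneg (Real.rpow_nonneg hx.1.le _) (Real.rpow_nonneg hy.1.le _)))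
  -- The witnesses are `U = I^1 G`, its `x`-derivative `x ^ (ρ₁ - 1)` times the `y`-integral of
  -- order one, and the pointwise weighted `G`. All of them lie in the cone, and both derivatives
  -- are of type (i).
  refine ⟨fun x y => ofEndPts (katInt2 1 1 ρ₁ ρ₂ g x y),
    fun x y => ofEndPts ((x ^ (ρ₁ - 1) * y ^ (ρ₂ - 1)) • g x y), fun x hx y hy => ?_,
    ⟨fun x y => ofEndPts (x ^ (ρ₁ - 1) • katIntE 1 ρ₂ (g x) y), GHType.i, GHType.i, ?_, ?_,
      fun x hx y hy => ⟨?_, ?_⟩⟩, fun x hx y hy => ?_⟩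
  · rw [isKatInt_iff_evals]
    intro L _
    have hGL : ContBdd (fun q : ℝ × ℝ => (fun s t => L (g s t)) q.1 q.2)
      (Ioc 0 a ×ˢ Ioc 0 b) := hG.clm L
    rw [hU x hx y hy, hg'.clm_katInt2 L one_pos one_pos hρ₁ hρ₂ hx hy,
      ← hGL.katInt2_katInt2 hφ₁ hφ₂ hρ₁ hρ₂ hx hy]
    refine katInt2_congr_Icc (sub_nonneg.2 hφ₁.2) (sub_nonneg.2 hφ₂.2) hx hy
      fun s hs t ht => ?_
    rw [hw s hs t ht, hg'.clm_katInt2 L hφ₁.1 hφ₂.1 hρ₁ hρ₂ hs ht]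
  · rw [← continuousOn_emb_iff]
    exact ((hg'.contBdd_katInt2 one_pos one_pos hρ₁ hρ₂).1.mono
      (prod_mono Ioc_subset_Icc_self Ioc_subset_Icc_self)).congr fun q hq =>
        hU q.1 (Ioc_subset_Icc_self hq.1) q.2 (Ioc_subset_Icc_self hq.2)
  · rw [← continuousOn_emb_iff]
    refine ContinuousOn.congr (ContinuousOn.smul (f := fun q : ℝ × ℝ => q.1 ^ (ρ₁ - 1)) ?_
      ((hg'.katIntE_param one_pos hρ₂).1.mono (prod_mono_right Ioc_subset_Icc_self)))
      fun q hq => hP q.1 hq.1 q.2 (Ioc_subset_Icc_self hq.2)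
    exact continuousOn_fst.rpow_const fun q hq => Or.inl hq.1.1.ne'
  · have hy' := Ioc_subset_Icc_self hy
    refine hasGHDerivOfType_i hx ?_ fun s hs t ht hst => ?_
    · rw [hP x hx y hy']
      exact (hg'.hasDerivWithinAt_katInt2_left hρ₁ hρ₂ hx hy').congr
        (fun s hs => hU s (Ioc_subset_Icc_self hs) y hy') (hU x (Ioc_subset_Icc_self hx) y hy')
    · rw [hU s (Ioc_subset_Icc_self hs) y hy', hU t (Ioc_subset_Icc_self ht) y hy']
      exact IsFuzzy.katIntE_one_sub (hg'.inner_katIntE one_pos hρ₂ hy') hρ₁ (fun s hs =>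
        IsFuzzy.isFuzzy_katIntE one_pos hρ₂ hy'.1 fun t ht => hgf s hs t ⟨ht.1, ht.2.trans hy.2⟩)
        hs.1.le hst ht.2
  · refine hasGHDerivOfType_i hy ?_ fun s hs t ht hst => ?_
    · rw [hQ x hx y hy]
      exact (hg'.hasDerivWithinAt_katInt2_right hρ₂ hx hy).congr
        (fun s hs => hP x hx s (Ioc_subset_Icc_self hs)) (hP x hx y (Ioc_subset_Icc_self hy))
    · rw [hP x hx s (Ioc_subset_Icc_self hs), hP x hx t (Ioc_subset_Icc_self ht), ← smul_sub]
      exact (IsFuzzy.katIntE_one_sub (hg'.slice_right (p := x) hx) hρ₂ (hgf x hx)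
        hs.1.le hst ht.2).smul (Real.rpow_nonneg hx.1.le _)
  · exact (isSMul_rpow_iff hx.1 hy.1).2 (hQ x hx y hy)

end FuzzyHat

/-! ### The integral equation, its equivalence with the Darboux problem, and the contraction -/

namespace FuzzyHat

open EndPts

/-- The closed rectangle `[0, a] × [0, b]`. -/
abbrev Rect (a b : ℝ) : Type := Icc (0 : ℝ) a × Icc (0 : ℝ) b

/-- The integral equation `v = h + I^φ F(x, y, v)`, in terms of end points. -/
def SolvesEmbEq (φ₁ φ₂ ρ₁ ρ₂ a b : ℝ) (F : ℝ → ℝ → FuzzyHat → FuzzyHat) (ξ₁ ξ₂ : ℝ → FuzzyHat)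
    (v : ℝ → ℝ → FuzzyHat) : Prop :=
  ∀ x ∈ Icc 0 a, ∀ y ∈ Icc 0 b, emb (v x y) = emb (ξ₁ x) + emb (ξ₂ y) - emb (ξ₁ 0) +
    katInt2 φ₁ φ₂ ρ₁ ρ₂ (fun s t => emb (F s t (v s t))) x y

section

variable {φ₁ φ₂ ρ₁ ρ₂ a b R : ℝ} {F : ℝ → ℝ → FuzzyHat → FuzzyHat} {ξ₁ ξ₂ : ℝ → FuzzyHat}
  {v : ℝ → ℝ → FuzzyHat}

/-- The values of `v` lie in a compact set, so the Lipschitz condition carries the bound on `F` at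
one fixed fuzzy number over to `F` along `v`. No limit of `F` at the axes is needed. -/
theorem contBdd_emb_comp (hR : 0 ≤ R)
    (hF : ContinuousOn (fun q : ℝ × ℝ × FuzzyHat => F q.1 q.2.1 q.2.2)
      (Ioc 0 a ×ˢ Ioc 0 b ×ˢ univ))
    (hFb : ∀ z : FuzzyHat,
      Bornology.IsBounded ((fun q : ℝ × ℝ => F q.1 q.2 z) '' (Ioc 0 a ×ˢ Ioc 0 b)))
    (hLip : ∀ x ∈ Ioc 0 a, ∀ y ∈ Ioc 0 b, ∀ u v : FuzzyHat,
      dist (F x y u) (F x y v) ≤ R * dist u v)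
    (hv : ContinuousOn (fun q : ℝ × ℝ => v q.1 q.2) (Icc 0 a ×ˢ Icc 0 b)) :
    ContBdd (fun q : ℝ × ℝ => emb (F q.1 q.2 (v q.1 q.2))) (Ioc 0 a ×ˢ Ioc 0 b) := by
  have hsub : Ioc 0 a ×ˢ Ioc 0 b ⊆ Icc 0 a ×ˢ Icc 0 b :=
    prod_mono Ioc_subset_Icc_self Ioc_subset_Icc_self
  refine ⟨continuousOn_emb_iff.2 (hF.comp (f := fun q : ℝ × ℝ => (q.1, q.2, v q.1 q.2))
    (continuousOn_fst.prodMk (continuousOn_snd.prodMk (hv.mono hsub)))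
    fun q hq => ⟨hq.1, hq.2, mem_univ _⟩), ?_⟩
  obtain ⟨z⟩ : Nonempty FuzzyHat := inferInstance
  obtain ⟨B, hB⟩ := (hFb z).subset_closedBall z
  obtain ⟨B', hB'⟩ := ((isCompact_Icc.prod isCompact_Icc).image_of_continuousOn
    hv).isBounded.subset_closedBall z
  refine ⟨R * B' + B + ‖emb z‖, fun q hq => ?_⟩
  have h1 : dist (F q.1 q.2 z) z ≤ B := hB ⟨q, hq, rfl⟩
  have h2 : dist (v q.1 q.2) z ≤ B' := hB' ⟨q, hsub hq, rfl⟩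
  have h3 := hLip q.1 hq.1 q.2 hq.2 (v q.1 q.2) z
  have h4 := dist_triangle (F q.1 q.2 (v q.1 q.2)) (F q.1 q.2 z) z
  have h5 := mul_le_mul_of_nonneg_left h2 hR
  have h6 := norm_le_norm_add_norm_sub' (emb (F q.1 q.2 (v q.1 q.2))) (emb z)
  rw [← dist_eq_norm, dist_emb] at h6
  linarith

/-- The assumed Hukuhara difference provides `h` as a fuzzy number, and the integral of a
cone-valued function provides `J`; the rest is linear. -/
theorem isIntegralSolution_iff (hφ₁ : 0 < φ₁) (hφ₂ : 0 < φ₂) (hρ₁ : 0 < ρ₁) (hρ₂ : 0 < ρ₂)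
    (hh : ∀ x ∈ Icc 0 a, ∀ y ∈ Icc 0 b, ∃ h : FuzzyHat, SumsEq (ξ₁ x) (ξ₂ y) (ξ₁ 0) h)
    (hG : ContBdd (fun q : ℝ × ℝ => emb (F q.1 q.2 (v q.1 q.2))) (Ioc 0 a ×ˢ Ioc 0 b))
    (hv : ContinuousOn (fun q : ℝ × ℝ => v q.1 q.2) (Icc 0 a ×ˢ Icc 0 b)) :
    IsIntegralSolution φ₁ φ₂ ρ₁ ρ₂ a b F ξ₁ ξ₂ v ↔
      SolvesEmbEq φ₁ φ₂ ρ₁ ρ₂ a b F ξ₁ ξ₂ v := by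
  rw [IsIntegralSolution, and_iff_right hv]
  refine forall₂_congr fun x hx => forall₂_congr fun y hy => ?_
  have hJ : ∀ J, _ ↔ _ := fun J =>
    isKatInt_iff_emb (u := fun s t => F s t (v s t)) (J := J) hG hφ₁ hφ₂ hρ₁ hρ₂ hx hy
  constructor
  · rintro ⟨h, J, h1, h2, h3⟩
    rw [sumsEq_iff] at h1
    rw [isSum_iff.1 h3, (hJ J).1 h2, h1]
    abel
  · intro h
    obtain ⟨k, hk⟩ := hh x hx y hy
    have hf : IsFuzzy (katInt2 φ₁ φ₂ ρ₁ ρ₂ (fun s t => emb (F s t (v s t))) x y) :=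
      IsFuzzy.isFuzzy_katInt2 hφ₁ hφ₂ hρ₁ hρ₂ hx hy fun _ _ _ _ => isFuzzy_emb _
    refine ⟨k, ofEndPts _, hk, (hJ _).2 (emb_ofEndPts hf), isSum_iff.2 ?_⟩
    rw [h, emb_ofEndPts hf, sumsEq_iff.1 hk]
    abel

/-- The integral vanishes on the axes, which leaves the boundary data there; `ξ₁ 0 = ξ₂ 0` is what
makes the value on `y = 0` equal to `ξ₁`. The corrected function `w` is the fractional integral
itself. -/
theorem SolvesEmbEq.isDarbouxSolution (ha : 0 < a) (hb : 0 < b)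
    (hφ₁ : φ₁ ∈ Ioc (0 : ℝ) 1) (hφ₂ : φ₂ ∈ Ioc (0 : ℝ) 1) (hρ₁ : 0 < ρ₁) (hρ₂ : 0 < ρ₂)
    (hξ : ξ₁ 0 = ξ₂ 0)
    (hG : ContBdd (fun q : ℝ × ℝ => emb (F q.1 q.2 (v q.1 q.2))) (Ioc 0 a ×ˢ Ioc 0 b))
    (hv : ContinuousOn (fun q : ℝ × ℝ => v q.1 q.2) (Icc 0 a ×ˢ Icc 0 b))
    (h : SolvesEmbEq φ₁ φ₂ ρ₁ ρ₂ a b F ξ₁ ξ₂ v) :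
    IsDarbouxSolution φ₁ φ₂ ρ₁ ρ₂ a b F ξ₁ ξ₂ v := by
  have hx0 : ∀ x ∈ Icc 0 a, v x 0 = ξ₁ x := fun x hx => emb_injective <| by
    rw [h x hx 0 ⟨le_rfl, hb.le⟩, katInt2_right_zero hφ₂.1, hξ]
    abel
  have h0y : ∀ y ∈ Icc 0 b, v 0 y = ξ₂ y := fun y hy => emb_injective <| by
    rw [h 0 ⟨le_rfl, ha.le⟩ y hy, katInt2_left_zero hφ₁.1]
    abel
  have hw : ∀ x ∈ Icc 0 a, ∀ y ∈ Icc 0 b,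
      emb (ofEndPts (katInt2 φ₁ φ₂ ρ₁ ρ₂ (fun s t => emb (F s t (v s t))) x y)) =
        katInt2 φ₁ φ₂ ρ₁ ρ₂ (fun s t => emb (F s t (v s t))) x y := fun x hx y hy =>
    emb_ofEndPts (IsFuzzy.isFuzzy_katInt2 hφ₁.1 hφ₂.1 hρ₁ hρ₂ hx hy fun _ _ _ _ => isFuzzy_emb _)
  refine ⟨hv, hx0, h0y,
    fun x y => ofEndPts (katInt2 φ₁ φ₂ ρ₁ ρ₂ (fun s t => emb (F s t (v s t))) x y),
    fun x hx y hy => ?_, hasKatDeriv_of_emb_eq hφ₁ hφ₂ hρ₁ hρ₂ hG hw⟩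
  rw [level_sums_iff, hw x hx y hy, hx0 x hx, h0y y hy, hx0 0 ⟨le_rfl, ha.le⟩, h x hx y hy]
  abel

/-- By cancellation `w` is determined by `v`. It inherits continuity from `v` and vanishes on the
axes by its algebraic form alone. -/
theorem IsDarbouxSolution.solvesEmbEq (ha : 0 < a) (hb : 0 < b)
    (hφ₁ : φ₁ ∈ Ioc (0 : ℝ) 1) (hφ₂ : φ₂ ∈ Ioc (0 : ℝ) 1) (hρ₁ : 0 < ρ₁) (hρ₂ : 0 < ρ₂)
    (hG : ContBdd (fun q : ℝ × ℝ => emb (F q.1 q.2 (v q.1 q.2))) (Ioc 0 a ×ˢ Ioc 0 b))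
    (h : IsDarbouxSolution φ₁ φ₂ ρ₁ ρ₂ a b F ξ₁ ξ₂ v) :
    SolvesEmbEq φ₁ φ₂ ρ₁ ρ₂ a b F ξ₁ ξ₂ v := by
  obtain ⟨hv, hx0, h0y, w, hw, hD⟩ := h
  have h0a : (0 : ℝ) ∈ Icc 0 a := ⟨le_rfl, ha.le⟩
  have h0b : (0 : ℝ) ∈ Icc 0 b := ⟨le_rfl, hb.le⟩
  have hw' : ∀ x ∈ Icc 0 a, ∀ y ∈ Icc 0 b,
      emb (w x y) = emb (v x y) + emb (v 0 0) - emb (v x 0) - emb (v 0 y) := by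
    intro x hx y hy
    rw [level_sums_iff.1 (hw x hx y hy)]
    abel
  have hve := continuousOn_emb_iff.2 hv
  have hwc : ContinuousOn (fun q : ℝ × ℝ => emb (w q.1 q.2)) (Icc 0 a ×ˢ Icc 0 b) := by
    refine ContinuousOn.congr (((hve.add continuousOn_const).sub ?_).sub ?_)
      fun q hq => hw' q.1 hq.1 q.2 hq.2
    · exact hve.comp (f := fun q : ℝ × ℝ => (q.1, (0 : ℝ))) (by fun_prop)
        fun q hq => ⟨hq.1, h0b⟩
    · exact hve.comp (f := fun q : ℝ × ℝ => ((0 : ℝ), q.2)) (by fun_prop)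
        fun q hq => ⟨h0a, hq.2⟩
  intro x hx y hy
  rw [← HasKatDeriv.emb_eq_katInt2 (w := w) (G := fun x y => F x y (v x y)) ha hb hφ₁ hφ₂ hρ₁
    hρ₂ hG hwc
    (fun y hy => by rw [hw' 0 h0a y hy]; abel) (fun x hx => by rw [hw' x hx 0 h0b]; abel)
    hD hx hy, hw' x hx y hy, hx0 x hx, h0y y hy, hx0 0 h0a]
  abel

/-- Existence and uniqueness for the integral equation, by contraction. -/
theorem exists_unique_solvesEmbEq (ha : 0 < a) (hb : 0 < b) (hφ₁ : 0 < φ₁) (hφ₂ : 0 < φ₂)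
    (hρ₁ : 0 < ρ₁) (hρ₂ : 0 < ρ₂)
    (hξ₁ : ContinuousOn ξ₁ (Icc 0 a)) (hξ₂ : ContinuousOn ξ₂ (Icc 0 b))
    (hh : ∀ x ∈ Icc 0 a, ∀ y ∈ Icc 0 b, ∃ h : FuzzyHat, SumsEq (ξ₁ x) (ξ₂ y) (ξ₁ 0) h)
    (hR : 0 ≤ R)
    (hLip : ∀ x ∈ Ioc 0 a, ∀ y ∈ Ioc 0 b, ∀ u v : FuzzyHat,
      dist (F x y u) (F x y v) ≤ R * dist u v)
    (hΞ : R / (Real.Gamma (φ₁ + 1) * Real.Gamma (φ₂ + 1)) *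
      (a ^ ρ₁ / ρ₁) ^ φ₁ * (b ^ ρ₂ / ρ₂) ^ φ₂ < 1)
    (hG : ∀ v : ℝ → ℝ → FuzzyHat,
      ContinuousOn (fun q : ℝ × ℝ => v q.1 q.2) (Icc 0 a ×ˢ Icc 0 b) →
      ContBdd (fun q : ℝ × ℝ => emb (F q.1 q.2 (v q.1 q.2))) (Ioc 0 a ×ˢ Ioc 0 b)) :
    ∃ v : ℝ → ℝ → FuzzyHat,
      ContinuousOn (fun q : ℝ × ℝ => v q.1 q.2) (Icc 0 a ×ˢ Icc 0 b) ∧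
      SolvesEmbEq φ₁ φ₂ ρ₁ ρ₂ a b F ξ₁ ξ₂ v ∧
      ∀ v' : ℝ → ℝ → FuzzyHat,
        ContinuousOn (fun q : ℝ × ℝ => v' q.1 q.2) (Icc 0 a ×ˢ Icc 0 b) →
        SolvesEmbEq φ₁ φ₂ ρ₁ ρ₂ a b F ξ₁ ξ₂ v' →
        ∀ x ∈ Icc 0 a, ∀ y ∈ Icc 0 b, v' x y = v x y := by
  have : Nonempty C(Rect a b, FuzzyHat) := ⟨ContinuousMap.const _ (Classical.arbitrary _)⟩
  -- The contraction lives on functions on the compact rectangle, whereas the integrals take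
  -- functions on the plane; clamping the arguments extends continuously.
  let extend : C(Rect a b, FuzzyHat) → ℝ → ℝ → FuzzyHat := fun f s t =>
    f (projIcc 0 a ha.le s, projIcc 0 b hb.le t)
  have hext : ∀ f, ContinuousOn (fun q : ℝ × ℝ => extend f q.1 q.2) (Icc 0 a ×ˢ Icc 0 b) :=
    fun f => (f.continuous.comp ((continuous_projIcc.comp continuous_fst).prodMk
      (continuous_projIcc.comp continuous_snd))).continuousOn
  have hext' : ∀ f : C(Rect a b, FuzzyHat), ∀ q : Rect a b, extend f q.1 q.2 = f q := fun f q => by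
    simp only [extend, projIcc_val]
  have hT : ∀ f : C(Rect a b, FuzzyHat), ∃ g : C(Rect a b, FuzzyHat), ∀ q : Rect a b,
      emb (g q) = emb (ξ₁ q.1) + emb (ξ₂ q.2) - emb (ξ₁ 0) +
        katInt2 φ₁ φ₂ ρ₁ ρ₂ (fun s t => emb (F s t (extend f s t))) q.1 q.2 := by
    intro f
    have hval : ∀ q : Rect a b, emb (ofEndPts (emb (ξ₁ q.1) + emb (ξ₂ q.2) - emb (ξ₁ 0) +
        katInt2 φ₁ φ₂ ρ₁ ρ₂ (fun s t => emb (F s t (extend f s t))) q.1 q.2)) =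
        emb (ξ₁ q.1) + emb (ξ₂ q.2) - emb (ξ₁ 0) +
        katInt2 φ₁ φ₂ ρ₁ ρ₂ (fun s t => emb (F s t (extend f s t))) q.1 q.2 := by
      intro q
      obtain ⟨k, hk⟩ := hh q.1 q.1.2 q.2 q.2.2
      -- The boundary terms equal `emb k`, so the right-hand side is a sum of two cone elements and
      -- defines a fuzzy number.
      rw [sumsEq_iff.1 hk, add_sub_cancel_left]
      exact emb_ofEndPts ((isFuzzy_emb k).add (IsFuzzy.isFuzzy_katInt2 hφ₁ hφ₂ hρ₁ hρ₂
        q.1.2 q.2.2 fun _ _ _ _ => isFuzzy_emb _))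
    refine ⟨⟨fun q => ofEndPts (emb (ξ₁ q.1) + emb (ξ₂ q.2) - emb (ξ₁ 0) +
      katInt2 φ₁ φ₂ ρ₁ ρ₂ (fun s t => emb (F s t (extend f s t))) q.1 q.2), ?_⟩, hval⟩
    rw [isometry_emb.isUniformInducing.isInducing.continuous_iff]
    have h1 : Continuous fun q : Rect a b => emb (ξ₁ q.1) :=
      (continuousOn_emb_iff.2 hξ₁).comp_continuous (by fun_prop) fun q => q.1.2
    have h2 : Continuous fun q : Rect a b => emb (ξ₂ q.2) :=
      (continuousOn_emb_iff.2 hξ₂).comp_continuous (by fun_prop) fun q => q.2.2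
    have h3 : Continuous fun q : Rect a b =>
        katInt2 φ₁ φ₂ ρ₁ ρ₂ (fun s t => emb (F s t (extend f s t))) q.1 q.2 :=
      (ContBdd.contBdd_katInt2 (f := fun s t => emb (F s t (extend f s t))) (hG _ (hext f))
        hφ₁ hφ₂ hρ₁ hρ₂).1.comp_continuous (f := fun q : Rect a b => ((q.1 : ℝ), (q.2 : ℝ)))
        (by fun_prop) fun q => ⟨q.1.2, q.2.2⟩
    exact (((h1.add h2).sub continuous_const).add h3).congr fun q => (hval q).symm
  choose T hT using hT
  have hΓ₁ : 0 < Real.Gamma (φ₁ + 1) := Real.Gamma_pos_of_pos (by linarith)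
  have hΓ₂ : 0 < Real.Gamma (φ₂ + 1) := Real.Gamma_pos_of_pos (by linarith)
  set Ξ := R / (Real.Gamma (φ₁ + 1) * Real.Gamma (φ₂ + 1)) *
    (a ^ ρ₁ / ρ₁) ^ φ₁ * (b ^ ρ₂ / ρ₂) ^ φ₂ with hΞ_eq
  have hΞ0 : 0 ≤ Ξ := by positivity
  have hcontr : ContractingWith ⟨Ξ, hΞ0⟩ T := by
    refine ⟨hΞ, LipschitzWith.of_dist_le_mul fun f g => ?_⟩
    refine (ContinuousMap.dist_le (mul_nonneg hΞ0 dist_nonneg)).2 fun q => ?_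
    rw [← dist_emb, hT, hT, dist_add_left, dist_eq_norm]
    refine (ContBdd.norm_katInt2_sub_le (f := fun s t => emb (F s t (extend f s t)))
      (g := fun s t => emb (F s t (extend g s t))) (hG _ (hext f)) (hG _ (hext g))
      hφ₁ hφ₂ hρ₁ hρ₂ q.1.2 q.2.2 (mul_nonneg hR (dist_nonneg (x := f) (y := g)))
      fun s hs t ht => ?_).trans (le_of_eq ?_)
    · rw [← dist_eq_norm, dist_emb]
      exact (hLip s hs t ht _ _).trans (mul_le_mul_of_nonneg_left
        (ContinuousMap.dist_apply_le_dist _) hR)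
    · change _ = Ξ * dist f g
      rw [hΞ_eq]
      field_simp
  have hfix := hcontr.fixedPoint_isFixedPt
  set f := hcontr.fixedPoint with hf
  refine ⟨extend f, hext f, fun x hx y hy => ?_, fun v' hv' hs x hx y hy => ?_⟩
  · have := hT f (⟨x, hx⟩, ⟨y, hy⟩)
    rw [hfix.eq] at this
    rw [← this]
    exact congrArg emb (hext' f (⟨x, hx⟩, ⟨y, hy⟩))
  · let f' : C(Rect a b, FuzzyHat) := ⟨fun q => v' q.1 q.2,
      hv'.comp_continuous (f := fun q : Rect a b => ((q.1 : ℝ), (q.2 : ℝ)))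
        (by fun_prop) fun q => ⟨q.1.2, q.2.2⟩⟩
    have hf' : ∀ s ∈ Icc 0 a, ∀ t ∈ Icc 0 b, extend f' s t = v' s t :=
      fun s hs t ht => hext' f' (⟨s, hs⟩, ⟨t, ht⟩)
    have hfix' : Function.IsFixedPt T f' := by
      refine ContinuousMap.ext fun q => emb_injective ?_
      -- The integral sees its integrand only on `Ω`, where the clamped extension agrees with `v'`.
      rw [hT, katInt2_congr (g := fun s t => emb (F s t (v' s t))) hφ₁ hφ₂ q.1.2 q.2.2
        fun s hs t ht => by rw [hf' s (Ioc_subset_Icc_self hs) t (Ioc_subset_Icc_self ht)]]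
      exact (hs q.1 q.1.2 q.2 q.2.2).symm
    rw [← hf' x hx y hy, hcontr.fixedPoint_unique hfix']

end

end FuzzyHat

theorem mainTheorem2
    (a b ρ₁ ρ₂ φ₁ φ₂ R : ℝ) (ha : 0 < a) (hb : 0 < b) (hρ₁ : 0 < ρ₁) (hρ₂ : 0 < ρ₂)
    (hφ₁ : φ₁ ∈ Ioc (0 : ℝ) 1) (hφ₂ : φ₂ ∈ Ioc (0 : ℝ) 1)
    (F : ℝ → ℝ → FuzzyHat → FuzzyHat) (ξ₁ ξ₂ : ℝ → FuzzyHat)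
    (hF : ContinuousOn (fun q : ℝ × ℝ × FuzzyHat => F q.1 q.2.1 q.2.2)
      (Ioc 0 a ×ˢ Ioc 0 b ×ˢ univ))
    (hFb : ∀ z : FuzzyHat,
      Bornology.IsBounded ((fun q : ℝ × ℝ => F q.1 q.2 z) '' (Ioc 0 a ×ˢ Ioc 0 b)))
    (hξ₁ : ContinuousOn ξ₁ (Icc 0 a)) (hξ₂ : ContinuousOn ξ₂ (Icc 0 b)) (hξ : ξ₁ 0 = ξ₂ 0)
    (hh : ∀ x ∈ Icc 0 a, ∀ y ∈ Icc 0 b, ∃ h : FuzzyHat,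
      FuzzyHat.SumsEq (ξ₁ x) (ξ₂ y) (ξ₁ 0) h)
    (hR : 0 < R)
    (hLip : ∀ x ∈ Ioc 0 a, ∀ y ∈ Ioc 0 b, ∀ u v : FuzzyHat,
      FuzzyNumber.D (F x y u).1 (F x y v).1 ≤ R * FuzzyNumber.D u.1 v.1)
    (hΞ : R / (Real.Gamma (φ₁ + 1) * Real.Gamma (φ₂ + 1)) *
      (a ^ ρ₁ / ρ₁) ^ φ₁ * (b ^ ρ₂ / ρ₂) ^ φ₂ < 1) :
    ∃ v : ℝ → ℝ → FuzzyHat,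
      FuzzyHat.IsDarbouxSolution φ₁ φ₂ ρ₁ ρ₂ a b F ξ₁ ξ₂ v ∧
      FuzzyHat.IsIntegralSolution φ₁ φ₂ ρ₁ ρ₂ a b F ξ₁ ξ₂ v ∧
      ∀ v' : ℝ → ℝ → FuzzyHat,
        FuzzyHat.IsDarbouxSolution φ₁ φ₂ ρ₁ ρ₂ a b F ξ₁ ξ₂ v' ∨
          FuzzyHat.IsIntegralSolution φ₁ φ₂ ρ₁ ρ₂ a b F ξ₁ ξ₂ v' →
        ∀ x ∈ Icc 0 a, ∀ y ∈ Icc 0 b, v' x y = v x y := by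
  -- The distance on the subtype unfolds to `D`, so the Lipschitz hypothesis is already a metric
  -- statement.
  have hLip' : ∀ x ∈ Ioc 0 a, ∀ y ∈ Ioc 0 b, ∀ u v : FuzzyHat,
      dist (F x y u) (F x y v) ≤ R * dist u v := hLip
  have hG : ∀ v : ℝ → ℝ → FuzzyHat,
      ContinuousOn (fun q : ℝ × ℝ => v q.1 q.2) (Icc 0 a ×ˢ Icc 0 b) →
      ContBdd (fun q : ℝ × ℝ => FuzzyHat.emb (F q.1 q.2 (v q.1 q.2))) (Ioc 0 a ×ˢ Ioc 0 b) :=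
    fun v hv => FuzzyHat.contBdd_emb_comp hR.le hF hFb hLip' hv
  obtain ⟨v, hv, hs, hu⟩ := FuzzyHat.exists_unique_solvesEmbEq ha hb hφ₁.1 hφ₂.1 hρ₁ hρ₂ hξ₁ hξ₂
    hh hR.le hLip' hΞ hG
  refine ⟨v, hs.isDarbouxSolution ha hb hφ₁ hφ₂ hρ₁ hρ₂ hξ (hG v hv) hv,
    (FuzzyHat.isIntegralSolution_iff hφ₁.1 hφ₂.1 hρ₁ hρ₂ hh (hG v hv) hv).2 hs, fun v' hv' => ?_⟩
  rcases hv' with h | h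
  · exact hu v' h.1 (h.solvesEmbEq ha hb hφ₁ hφ₂ hρ₁ hρ₂ (hG v' h.1))
  · exact hu v' h.1
      ((FuzzyHat.isIntegralSolution_iff hφ₁.1 hφ₂.1 hρ₁ hρ₂ hh (hG v' h.1) h.1).1 h)
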